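/- Let $n\ge 2$ be an integer. For a multi-index $\alpha\in\mathbb{Z}_{\ge0}^n$ write $|\alpha|=\alpha_1+\dots+\alpha_n$, $\alpha!=\alpha_1!\cdots\alpha_n!$, $x^\alpha=x_1^{\alpha_1}\cdots x_n^{\alpha_n}$, and let $\gamma\le\beta$ be understood componentwise. Let $$h_\alpha(x)=\frac{(-1)^{|\alpha|}}{\pi^{n/4}2^{|\alpha|/2}(\alpha!)^{1/2}}\,e^{|x|^2/2}\,\frac{\partial^{|\alpha|}}{\partial x_1^{\alpha_1}\cdots\partial x_n^{\alpha_n}}\,e^{-|x|^2},\qquad x\in\mathbb{R}^n,$$ be the Hermite functions, and put $$M(n,1,\alpha)=\int_{\mathbb{S}^{n-1}}\omega^\alpha\,d\sigma(\omega),$$ where $d\sigma$ is the surface measure of the unit sphere $\mathbb{S}^{n-1}\subset\mathbb{R}^n$. Let $\lambda\in\mathbb{C}$ with $\operatorname{Re}\lambda>-n$. Then the function $|x|^\lambda$ defines a tempered distribution on $\mathbb{R}^n$, and it has a unique Hermite expansion $$|x|^\lambda=\sum_{\alpha}a_\alpha(\lambda)\,h_\alpha\quad\text{in }\mathscr{S}'(\mathbb{R}^n)$$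 (unconditional convergence, tested against each Schwartz function). Its coefficients are $a_\alpha(\lambda)=\langle |x|^\lambda,h_\alpha\rangle$, and they are given as follows. For every $\beta\in\mathbb{Z}_{\ge0}^n$, $$a_{2\beta}(\lambda)=\pi^{-n/4}\,2^{2|\beta|+(\lambda+n)/2-1}\,\bigl((2\beta)!\bigr)^{1/2}\sum_{\gamma\le\beta}\frac{\Gamma\!\left(|\beta-\gamma|+\frac{\lambda+n}{2}\right)}{\gamma!\,(2\beta-2\gamma)!}\cdot\frac{(-1)^{|\gamma|}}{2^{3|\gamma|}}\cdot M(n,1,2\beta-2\gamma),$$ and $a_\alpha(\lambda)=0$ whenever $\alpha\notin 2\,\mathbb{Z}_{\ge0}^n$. -/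

import Mathlib

open MeasureTheory
open scoped SchwartzMap

noncomputable section

namespace HermiteExp

/-- Euclidean space `ℝⁿ`. -/
abbrev Rn (n : ℕ) : Type := EuclideanSpace ℝ (Fin n)

/-- The length `|α|` of a multi-index. -/
def mlen {n : ℕ} (α : Fin n → ℕ) : ℕ := ∑ i, α i

/-- The factorial `α!` of a multi-index. -/
def mfact {n : ℕ} (α : Fin n → ℕ) : ℕ := ∏ i, (α i).factorial

/-- The monomial `x ^ α`. -/
def mpow {n : ℕ} (x : Rn n) (α : Fin n → ℕ) : ℝ := ∏ i, x i ^ α i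

/-- The partial derivative `∂f/∂xᵢ`. -/
def pderiv {n : ℕ} (i : Fin n) (f : Rn n → ℝ) : Rn n → ℝ :=
  fun x => lineDeriv ℝ f x (EuclideanSpace.single i 1)

/-- The iterated partial derivative `∂₁^α₁ ⋯ ∂ₙ^αₙ f`. -/
def mderiv {n : ℕ} (α : Fin n → ℕ) (f : Rn n → ℝ) : Rn n → ℝ :=
  (List.finRange n).foldr (fun i g => (pderiv i)^[α i] g) f

/-- The Hermite function
`h_α(x) = (-1)^|α| / (π^(n/4) 2^(|α|/2) (α!)^(1/2)) * e^(x²/2) * ∂^α e^(-x²)`. -/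
def hermiteFn {n : ℕ} (α : Fin n → ℕ) (x : Rn n) : ℝ :=
  (-1) ^ mlen α / (Real.pi ^ ((n : ℝ) / 4) * 2 ^ ((mlen α : ℝ) / 2) * √(mfact α : ℝ))
    * Real.exp (‖x‖ ^ 2 / 2) * mderiv α (fun y => Real.exp (-‖y‖ ^ 2)) x

lemma contDiff_gauss (n : ℕ) : ContDiff ℝ (⊤ : ℕ∞) (fun x : Rn n => Real.exp (-(‖x‖ ^ 2 / 2))) :=
  Real.contDiff_exp.comp ((contDiff_norm_sq ℝ).div_const 2).neg

lemma gauss_decay (n k m : ℕ) : ∃ C : ℝ, ∀ x : Rn n,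
    ‖x‖ ^ k * ‖iteratedFDeriv ℝ m (fun x : Rn n => Real.exp (-(‖x‖ ^ 2 / 2))) x‖ ≤ C := by
  have hf : (fun x : Rn n => -(‖x‖ ^ 2 / 2)).HasTemperateGrowth := by
    have h := (Function.HasTemperateGrowth.const (E := Rn n) (-(1 / 2 : ℝ))).mul
      (Function.hasTemperateGrowth_norm_sq (H := Rn n))
    have e : (fun x : Rn n => -(‖x‖ ^ 2 / 2)) = (fun _ : Rn n => (-(1 / 2 : ℝ))) * fun x => ‖x‖ ^ 2 := by
      funext x
      simp only [Pi.mul_apply]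
      ring
    rw [e]
    exact h
  obtain ⟨N, C, hC, hb⟩ := hf.norm_iteratedFDeriv_le_uniform m
  obtain ⟨A, hA⟩ : ∃ A : ℝ, ∀ t : ℝ, 0 ≤ t →
      (1 + t) ^ (k + N * m) * Real.exp (-(t ^ 2 / 2)) ≤ A := by
    refine ⟨(k + N * m).factorial * Real.exp 2, fun t ht => ?_⟩
    have h1 : (1 + t) ^ (k + N * m) / (k + N * m).factorial ≤ Real.exp (1 + t) :=
      Real.pow_div_factorial_le_exp (1 + t) (by linarith) _
    have h2 : (1 + t) ^ (k + N * m) ≤ (k + N * m).factorial * Real.exp (1 + t) := by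
      rw [div_le_iff₀ (by positivity)] at h1
      linarith
    calc (1 + t) ^ (k + N * m) * Real.exp (-(t ^ 2 / 2))
        ≤ ((k + N * m).factorial * Real.exp (1 + t)) * Real.exp (-(t ^ 2 / 2)) := by gcongr
      _ = (k + N * m).factorial * Real.exp (1 + t + -(t ^ 2 / 2)) := by rw [mul_assoc, ← Real.exp_add]
      _ ≤ (k + N * m).factorial * Real.exp 2 := by
          gcongr
          nlinarith [sq_nonneg (t - 1)]
  refine ⟨m.factorial * (1 + C) ^ m * A, fun x => ?_⟩
  have key : ‖iteratedFDeriv ℝ m (Real.exp ∘ fun x : Rn n => -(‖x‖ ^ 2 / 2)) x‖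
      ≤ m.factorial * Real.exp (-(‖x‖ ^ 2 / 2)) * ((1 + C) * (1 + ‖x‖) ^ N) ^ m := by
    refine norm_iteratedFDeriv_comp_le (n := m) (N := (⊤ : ℕ∞)) Real.contDiff_exp hf.1
      (by exact_mod_cast le_top) x ?_ ?_
    · intro i _
      rw [norm_iteratedFDeriv_eq_norm_iteratedDeriv, iteratedDeriv_eq_iterate]
      simp [abs_of_pos (Real.exp_pos _)]
    · intro i hi him
      have hD : 1 ≤ (1 + C) * (1 + ‖x‖) ^ N :=
        one_le_mul_of_one_le_of_one_le (by linarith)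
          (one_le_pow₀ (by linarith [norm_nonneg x]))
      calc _ ≤ C * (1 + ‖x‖) ^ N := hb i him x
        _ ≤ (1 + C) * (1 + ‖x‖) ^ N := by gcongr; linarith
        _ ≤ _ := le_self_pow₀ hD (by omega)
  calc ‖x‖ ^ k * _ ≤ (1 + ‖x‖) ^ k *
        (m.factorial * Real.exp (-(‖x‖ ^ 2 / 2)) * ((1 + C) * (1 + ‖x‖) ^ N) ^ m) := by
        gcongr
        · linarith
        · exact key
    _ = m.factorial * (1 + C) ^ m * ((1 + ‖x‖) ^ (k + N * m) * Real.exp (-(‖x‖ ^ 2 / 2))) := by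
        rw [mul_pow, pow_add, pow_mul]
        ring
    _ ≤ _ := by
        gcongr
        exact hA _ (norm_nonneg x)

/-- The Gaussian `e^(-x²/2)` as a Schwartz function. -/
def gaussS (n : ℕ) : 𝓢(Rn n, ℝ) where
  toFun x := Real.exp (-(‖x‖ ^ 2 / 2))
  smooth' := contDiff_gauss n
  decay' := gauss_decay n

lemma pderiv_step {n : ℕ} (i : Fin n) (g : Rn n → ℝ)
    (h : ∃ s : 𝓢(Rn n, ℝ), ∀ x, g x = Real.exp (-(‖x‖ ^ 2 / 2)) * s x) :
    ∃ s : 𝓢(Rn n, ℝ), ∀ x, pderiv i g x = Real.exp (-(‖x‖ ^ 2 / 2)) * s x := by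
  obtain ⟨s, hs⟩ := h
  set v : Rn n := EuclideanSpace.single i 1
  refine ⟨LineDeriv.lineDerivOp v s - SchwartzMap.smulLeftCLM ℝ (fun x : Rn n => inner ℝ v x) s,
    fun x => ?_⟩
  have e : g = fun x => Real.exp (-(‖x‖ ^ 2 / 2)) * s x := funext hs
  have hE : HasFDerivAt (fun x : Rn n => Real.exp (-(‖x‖ ^ 2 / 2)))
      (Real.exp (-(‖x‖ ^ 2 / 2)) • (-((1 / 2 : ℝ) • ((2 : ℕ) • innerSL ℝ x)))) x := by
    have h1 : HasFDerivAt (fun x : Rn n => ‖x‖ ^ 2) ((2 : ℕ) • innerSL ℝ x) x := by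
      simpa using (hasStrictFDerivAt_norm_sq x).hasFDerivAt
    have h2 := (h1.const_mul (1 / 2 : ℝ)).neg.exp
    have e2 : ∀ y : Rn n, -(‖y‖ ^ 2 / 2) = -(1 / 2 * ‖y‖ ^ 2) := fun y => by ring
    simpa [e2] using h2
  have hg := hE.mul s.differentiableAt.hasFDerivAt
  have hg' := (hg.hasLineDerivAt v).lineDeriv
  change lineDeriv ℝ g x v = _
  rw [e]
  change lineDeriv ℝ (fun x => Real.exp (-(‖x‖ ^ 2 / 2)) * s x) x v = _ at hg'
  rw [hg', sub_apply, SchwartzMap.smulLeftCLM_apply_apply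
    (Function.hasTemperateGrowth_inner_right v), SchwartzMap.lineDerivOp_apply_eq_fderiv]
  simp [real_inner_comm]
  ring

lemma mderiv_gauss {n : ℕ} (α : Fin n → ℕ) : ∃ s : 𝓢(Rn n, ℝ), ∀ x,
    mderiv α (fun y => Real.exp (-‖y‖ ^ 2)) x = Real.exp (-(‖x‖ ^ 2 / 2)) * s x := by
  unfold mderiv
  induction List.finRange n with
  | nil =>
    refine ⟨gaussS n, fun x => ?_⟩
    change Real.exp (-‖x‖ ^ 2) = Real.exp (-(‖x‖ ^ 2 / 2)) * Real.exp (-(‖x‖ ^ 2 / 2))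
    rw [← Real.exp_add]
    ring_nf
  | cons i l ih =>
    rw [List.foldr_cons]
    induction α i with
    | zero => exact ih
    | succ k ihk =>
      rw [Function.iterate_succ_apply']
      exact pderiv_step i _ ihk

lemma hermiteFn_schwartz {n : ℕ} (α : Fin n → ℕ) :
    ∃ s : 𝓢(Rn n, ℂ), ∀ x, (hermiteFn α x : ℂ) = s x := by
  obtain ⟨s, hs⟩ := mderiv_gauss α
  refine ⟨SchwartzMap.postcompCLM (𝕜 := ℝ) Complex.ofRealCLM (((-1) ^ mlen α /
    (Real.pi ^ ((n : ℝ) / 4) * 2 ^ ((mlen α : ℝ) / 2) * √(mfact α : ℝ))) • s), fun x => ?_⟩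
  rw [SchwartzMap.postcompCLM_apply, smul_apply]
  simp only [Complex.ofRealCLM_apply, smul_eq_mul]
  congr 1
  rw [hermiteFn, hs, mul_assoc, ← mul_assoc (Real.exp _), ← Real.exp_add]
  simp

/-- The Hermite function `h_α` as an element of the Schwartz class `𝓢(ℝⁿ)`. -/
def hermite {n : ℕ} (α : Fin n → ℕ) : 𝓢(Rn n, ℂ) where
  toFun x := (hermiteFn α x : ℂ)
  smooth' := by
    obtain ⟨s, hs⟩ := hermiteFn_schwartz α
    rw [funext hs]
    exact s.smooth'
  decay' := by
    obtain ⟨s, hs⟩ := hermiteFn_schwartz α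
    rw [funext hs]
    exact s.decay'

/-- `T = ∑_α a_α h_α` in `𝓢'(ℝⁿ)`: unconditional convergence in the space of tempered
distributions, `h_α` being the tempered distribution `φ ↦ ∫ φ h_α`. -/
def IsHermiteExpansion {n : ℕ} (T : 𝓢'(Rn n, ℂ)) (a : (Fin n → ℕ) → ℂ) : Prop :=
  HasSum (fun α => a α • SchwartzMap.toTemperedDistributionCLM (Rn n) ℂ volume (hermite α)) T

/-- The tempered distribution `T` is the function `f`: the function is integrable against every
Schwartz function `φ`, and `⟨T, φ⟩ = ∫ f φ`. -/
def IsGivenBy {n : ℕ} (T : 𝓢'(Rn n, ℂ)) (f : Rn n → ℂ) : Prop :=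
  ∀ φ : 𝓢(Rn n, ℂ), Integrable (fun x => f x * φ x) ∧ T φ = ∫ x, f x * φ x

/-- The moment `M(n, K, α) = ∫_{S^(n-1)} ω^α K(ω) dσ(ω)`, where `dσ` is the surface measure of the
unit sphere (the measure for which Lebesgue measure in polar coordinates is `r^(n-1) dr dσ`). -/
def sphereMoment (n : ℕ) (K : Metric.sphere (0 : Rn n) 1 → ℂ) (α : Fin n → ℕ) : ℂ :=
  ∫ ω : Metric.sphere (0 : Rn n) 1, (mpow (ω : Rn n) α : ℂ) * K ω
    ∂(volume : Measure (Rn n)).toSphere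

end HermiteExp

end

open MeasureTheory
open scoped SchwartzMap LineDeriv

noncomputable section

namespace HermiteExp

/-! Orthonormality settles uniqueness and identifies the coefficients: testing an expansion on
`hermite β` leaves the single term a_β (`IsHermiteExpansion.eq_apply`). For existence, weighted sup
norms of h_α grow at most polynomially in α (`abs_hermiteFn_le`), while the coefficients of a
Schwartz function φ decay faster than any power (`norm_coeff_mul_mweight_pow_le`), because x_i ± ∂_i
preserve the Schwartz class and shift the coefficients with known factors. So the Hermite series of
φ converges absolutely, even after multiplication by (1 + |x|)^m. Its sum is φ
(`hasSum_coeff_mul_hermite`): the difference is bounded, continuous and orthogonal to every h_α, and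
such a function vanishes, since its product with a Gaussian has zero Fourier transform. As |x|^λ is
integrable against some (1 + |x|)^(-k), the series may be integrated term by term against it.

The coefficients are then integrals of |x|^λ h_α. If some entry of α is odd, a reflection kills the
integral. For α = 2β, h_α is a sum of monomials times e^(-|x|²/2), and polar coordinates turn each
term into a sphere moment times a Gaussian Mellin integral, which is a Gamma value. -/

/-! ### Hermite polynomials: coefficients and parity -/

open Polynomial in
/-- The physicists' Hermite polynomials. -/
def physHermite : ℕ → Polynomial ℝ
  | 0 => 1
  | k + 1 => C 2 * X * physHermite k - derivative (physHermite k)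

open Polynomial in
lemma derivative_physHermite_succ (k : ℕ) :
    derivative (physHermite (k + 1)) = C (2 * ((k : ℝ) + 1)) * physHermite k := by
  induction k with
  | zero => simp [physHermite]
  | succ k ih =>
    have h : physHermite (k + 1) = C 2 * X * physHermite k - derivative (physHermite k) := rfl
    rw [physHermite, derivative_sub, mul_assoc, derivative_C_mul, derivative_mul, ih,
      derivative_C_mul, derivative_X, h]
    simp only [Nat.cast_add, Nat.cast_one, C_mul, C_add, C_1]
    ring

lemma natDegree_physHermite_le (k : ℕ) : (physHermite k).natDegree ≤ k := by
  induction k with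
  | zero => simp [physHermite]
  | succ k ihk =>
    rw [physHermite]
    refine (Polynomial.natDegree_sub_le _ _).trans (max_le ?_ ?_)
    · refine Polynomial.natDegree_mul_le.trans ?_
      have := Polynomial.natDegree_C_mul_le (2 : ℝ) Polynomial.X
      have := Polynomial.natDegree_X (R := ℝ)
      omega
    · have := Polynomial.natDegree_derivative_le (physHermite k)
      omega

/-- Writing the index as 2g + j builds the parity condition in and avoids subtraction. In the
recurrence for H_(m+1), with m + 1 = 2g + j, the term 2X·H_m supplies the share j of a common factor
and the derivative term the share 2g; together they give the factor m + 1 that completes the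
factorial. -/
lemma coeff_physHermite (g j : ℕ) :
    (physHermite (2 * g + j)).coeff j =
      (-1) ^ g * (2 * g + j).factorial * 2 ^ j / (g.factorial * j.factorial) := by
  obtain ⟨m, hm⟩ : ∃ m, m = 2 * g + j := ⟨_, rfl⟩
  induction m generalizing g j with
  | zero =>
    obtain ⟨rfl, rfl⟩ : g = 0 ∧ j = 0 := by omega
    simp [physHermite]
  | succ m ih =>
    rw [← hm, physHermite, mul_assoc, Polynomial.coeff_sub, Polynomial.coeff_C_mul,
      Polynomial.coeff_derivative]
    have hA : 2 * (Polynomial.X * physHermite m).coeff j =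
        (-1 : ℝ) ^ g * m.factorial * 2 ^ j / (g.factorial * j.factorial) * j := by
      cases j with
      | zero => simp
      | succ j =>
        rw [Polynomial.coeff_X_mul, show m = 2 * g + j by omega, ih g j (by omega)]
        rw [Nat.factorial_succ j]
        push_cast
        field_simp
        ring
    have hB : (physHermite m).coeff (j + 1) * (j + 1) =
        -((-1) ^ g * m.factorial * 2 ^ j / (g.factorial * j.factorial) * (2 * g)) := by
      cases g with
      | zero =>
        have : (physHermite m).coeff (j + 1) = 0 :=
          Polynomial.coeff_eq_zero_of_natDegree_lt
            ((natDegree_physHermite_le m).trans_lt (by omega))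
        simp [this]
      | succ g =>
        rw [show m = 2 * g + (j + 1) by omega, ih g (j + 1) (by omega), Nat.factorial_succ g,
          Nat.factorial_succ j]
        push_cast
        field_simp
        ring
    rw [hA, hB, Nat.factorial_succ]
    have : (m : ℝ) + 1 = 2 * g + j := by exact_mod_cast hm
    push_cast
    rw [this]
    ring

lemma coeff_physHermite_odd (m j : ℕ) (h : Odd (m + j)) : (physHermite m).coeff j = 0 := by
  induction m generalizing j with
  | zero =>
    rw [physHermite, Polynomial.coeff_one, if_neg]
    rintro rfl
    simp at h
  | succ m ih =>
    rw [physHermite, mul_assoc, Polynomial.coeff_sub, Polynomial.coeff_C_mul,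
      Polynomial.coeff_derivative, ih (j + 1) (by convert h using 1; ring)]
    cases j with
    | zero => simp
    | succ j =>
      rw [Polynomial.coeff_X_mul, ih j (by
        rw [show m + 1 + (j + 1) = m + j + 2 by ring, Nat.odd_add] at h
        simpa using h)]
      simp

lemma eval_physHermite_even (b : ℕ) (t : ℝ) :
    (physHermite (2 * b)).eval t = (2 * b).factorial * ∑ g ∈ Finset.Icc 0 b,
      (-1) ^ g * (2 * t) ^ (2 * b - 2 * g) / (g.factorial * (2 * b - 2 * g).factorial) := by
  rw [Polynomial.eval_eq_sum_range' (Nat.lt_succ_of_le (natDegree_physHermite_le (2 * b))),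
    Finset.mul_sum]
  symm
  -- The exponents 2b - 2g exhaust the degrees of the right parity; all other coefficients vanish.
  refine Finset.sum_of_injOn (fun g => 2 * b - 2 * g) ?_ ?_ ?_ ?_
  · intro x hx y hy h
    simp at hx hy h
    omega
  · intro x hx
    simp
  · intro j hj hn
    rcases Nat.even_or_odd (2 * b + j) with he | ho
    · exfalso
      apply hn
      simp at hj ⊢
      obtain ⟨c, hc⟩ := he
      exact ⟨2 * b - c, by omega, by omega⟩
    · rw [coeff_physHermite_odd _ _ ho, zero_mul]
  · intro g hg
    simp at hg
    have := coeff_physHermite g (2 * b - 2 * g)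
    rw [show 2 * g + (2 * b - 2 * g) = 2 * b by omega] at this
    rw [this, mul_pow]
    ring

lemma eval_physHermite_neg (k : ℕ) (t : ℝ) :
    (physHermite k).eval (-t) = (-1) ^ k * (physHermite k).eval t := by
  simp only [Polynomial.eval_eq_sum_range, Finset.mul_sum]
  refine Finset.sum_congr rfl fun j _ => ?_
  rcases Nat.even_or_odd (k + j) with he | ho
  · have h : (-1 : ℝ) ^ k = (-1) ^ j := by
      have h1 : (-1 : ℝ) ^ k * (-1) ^ j = 1 := by rw [← pow_add, he.neg_one_pow]
      rcases neg_one_pow_eq_or ℝ j with h2 | h2 <;> rw [h2] at h1 ⊢ <;> linarith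
    rw [neg_pow t, h]
    ring
  · simp [coeff_physHermite_odd _ _ ho]

/-- The iterated derivatives of `e^(-t²)` in terms of Hermite polynomials. -/
lemma hasDerivAt_physHermite_mul_exp (k : ℕ) (t : ℝ) :
    HasDerivAt (fun t => (-1) ^ k * (physHermite k).eval t * Real.exp (-t ^ 2))
      ((-1) ^ (k + 1) * (physHermite (k + 1)).eval t * Real.exp (-t ^ 2)) t := by
  have h1 : HasDerivAt (fun t : ℝ => Real.exp (-t ^ 2)) (Real.exp (-t ^ 2) * (-(2 * t))) t := by
    simpa using ((hasDerivAt_pow 2 t).fun_neg).exp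
  have h := (((physHermite k).hasDerivAt t).const_mul ((-1) ^ k)).mul h1
  refine h.congr_deriv ?_
  simp only [physHermite, Polynomial.eval_sub, Polynomial.eval_mul, Polynomial.eval_C,
    Polynomial.eval_X]
  ring

/-! ### One-dimensional Hermite functions: ladder relations, orthonormality, bounds -/

/-- The normalising factor of the one-dimensional Hermite functions. -/
def hermiteNorm (k : ℕ) : ℝ := Real.pi ^ ((1 : ℝ) / 4) * 2 ^ ((k : ℝ) / 2) * √(k.factorial : ℝ)

lemma hermiteNorm_pos (k : ℕ) : 0 < hermiteNorm k := by
  have := Real.pi_pos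
  have : (0 : ℝ) < k.factorial := by exact_mod_cast k.factorial_pos
  unfold hermiteNorm
  positivity

lemma hermiteNorm_succ (k : ℕ) :
    hermiteNorm (k + 1) = √(2 * ((k : ℝ) + 1)) * hermiteNorm k := by
  unfold hermiteNorm
  rw [Nat.factorial_succ]
  push_cast
  rw [Real.sqrt_mul (by positivity), Real.sqrt_mul (by positivity), add_div,
    Real.rpow_add (by norm_num), ← Real.sqrt_eq_rpow 2]
  ring

/-- The one-dimensional Hermite functions. -/
def hermite1D (k : ℕ) (t : ℝ) : ℝ :=
  (hermiteNorm k)⁻¹ * (physHermite k).eval t * Real.exp (-(t ^ 2 / 2))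

lemma sqrt_mul_hermite1D_succ (k : ℕ) (t : ℝ) :
    √(2 * ((k : ℝ) + 1)) * hermite1D (k + 1) t =
      (hermiteNorm k)⁻¹ * (physHermite (k + 1)).eval t * Real.exp (-(t ^ 2 / 2)) := by
  have h0 : √(2 * ((k : ℝ) + 1)) ≠ 0 := by positivity
  rw [hermite1D, hermiteNorm_succ, mul_inv]
  field_simp

/-- This is H_k' = 2k·H_(k-1) after normalisation. At k = 0 the truncated index k - 1 is harmless,
because its factor √(2k) is zero. -/
lemma sqrt_mul_hermite1D_pred (k : ℕ) (t : ℝ) :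
    √(2 * (k : ℝ)) * hermite1D (k - 1) t =
      (hermiteNorm k)⁻¹ * (physHermite k).derivative.eval t * Real.exp (-(t ^ 2 / 2)) := by
  cases k with
  | zero => simp [physHermite]
  | succ k =>
    have h0 : √(2 * ((k : ℝ) + 1)) ≠ 0 := by positivity
    have h3 : √(2 * ((k : ℝ) + 1)) ^ 2 = 2 * ((k : ℝ) + 1) := Real.sq_sqrt (by positivity)
    rw [hermite1D, hermiteNorm_succ, mul_inv, derivative_physHermite_succ, Polynomial.eval_C_mul,
      ← h3]
    push_cast
    field_simp
    rw [Real.sqrt_sq (Real.sqrt_nonneg _)]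
    ring

lemma two_mul_mul_hermite1D (k : ℕ) (t : ℝ) :
    2 * t * hermite1D k t =
      √(2 * (k : ℝ)) * hermite1D (k - 1) t + √(2 * ((k : ℝ) + 1)) * hermite1D (k + 1) t := by
  rw [sqrt_mul_hermite1D_succ, sqrt_mul_hermite1D_pred, hermite1D, physHermite]
  simp
  ring

lemma hasDerivAt_hermite1D (k : ℕ) (t : ℝ) :
    HasDerivAt (hermite1D k)
      (-(t * hermite1D k t) + √(2 * (k : ℝ)) * hermite1D (k - 1) t) t := by
  have h1 : HasDerivAt (fun t : ℝ => Real.exp (-(t ^ 2 / 2))) (Real.exp (-(t ^ 2 / 2)) * (-t)) t := by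
    refine (((hasDerivAt_pow 2 t).div_const 2).fun_neg.exp).congr_deriv ?_
    norm_num
  have h := (((physHermite k).hasDerivAt t).const_mul (hermiteNorm k)⁻¹).mul h1
  refine h.congr_deriv ?_
  rw [sqrt_mul_hermite1D_pred, hermite1D]
  ring

lemma hasDerivAt_hermite1D' (k : ℕ) (t : ℝ) :
    HasDerivAt (hermite1D k)
      (t * hermite1D k t - √(2 * ((k : ℝ) + 1)) * hermite1D (k + 1) t) t := by
  refine (hasDerivAt_hermite1D k t).congr_deriv ?_
  linear_combination - two_mul_mul_hermite1D k t

lemma integrable_polynomial_mul_gaussian (p : Polynomial ℝ) {b : ℝ} (hb : 0 < b) :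
    Integrable fun t : ℝ => p.eval t * Real.exp (-b * t ^ 2) := by
  induction p using Polynomial.induction_on' with
  | add p q hp hq => 
    refine (hp.add hq).congr (.of_forall fun t => ?_)
    simp [add_mul]
  | monomial n a =>
    have := (integrable_rpow_mul_exp_neg_mul_sq hb (s := n) (by
      have : (0 : ℝ) ≤ n := n.cast_nonneg
      linarith)).const_mul a
    simpa [mul_assoc] using this

lemma integrable_hermite1D_mul (p : Polynomial ℝ) (k l : ℕ) :
    Integrable fun t : ℝ => p.eval t * hermite1D k t * hermite1D l t := by
  have := (integrable_polynomial_mul_gaussian (p * physHermite k * physHermite l)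
    one_pos).const_mul ((hermiteNorm k)⁻¹ * (hermiteNorm l)⁻¹)
  refine this.congr (.of_forall fun t => ?_)
  have : Real.exp (-1 * t ^ 2) = Real.exp (-(t ^ 2 / 2)) * Real.exp (-(t ^ 2 / 2)) := by
    rw [← Real.exp_add]
    ring_nf
  simp only [this, Polynomial.eval_mul, hermite1D]
  ring

lemma integrable_hermite1D_mul_hermite1D (k l : ℕ) :
    Integrable fun t : ℝ => hermite1D k t * hermite1D l t := by
  simpa using integrable_hermite1D_mul 1 k l

/-- The derivative of h_j h_k integrates to zero over the line. With h_j' in raising form and h_k'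
in lowering form the terms t·h_j·h_k cancel, and only the two integrals in question remain. -/
lemma integral_hermite1D_ladder (j k : ℕ) :
    √(2 * ((j : ℝ) + 1)) * ∫ t, hermite1D (j + 1) t * hermite1D k t =
      √(2 * (k : ℝ)) * ∫ t, hermite1D j t * hermite1D (k - 1) t := by
  have h0 := integral_eq_zero_of_hasDerivAt_of_integrable
    (fun t => ((hasDerivAt_hermite1D' j t).mul (hasDerivAt_hermite1D k t)).congr_deriv
      (g' := √(2 * (k : ℝ)) * (hermite1D j t * hermite1D (k - 1) t) -
        √(2 * ((j : ℝ) + 1)) * (hermite1D (j + 1) t * hermite1D k t)) (by ring))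
    (((integrable_hermite1D_mul_hermite1D _ _).const_mul _).sub
      ((integrable_hermite1D_mul_hermite1D _ _).const_mul _))
    (integrable_hermite1D_mul_hermite1D _ _)
  rw [integral_sub ((integrable_hermite1D_mul_hermite1D _ _).const_mul _)
      ((integrable_hermite1D_mul_hermite1D _ _).const_mul _), integral_const_mul,
      integral_const_mul] at h0
  linarith

lemma integral_hermite1D_zero : ∫ t, hermite1D 0 t * hermite1D 0 t = 1 := by
  have h : ∀ t, hermite1D 0 t * hermite1D 0 t = (√Real.pi)⁻¹ * Real.exp (-1 * t ^ 2) := by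
    intro t
    have h1 : Real.exp (-1 * t ^ 2) = Real.exp (-(t ^ 2 / 2)) * Real.exp (-(t ^ 2 / 2)) := by
      rw [← Real.exp_add]
      ring_nf
    have h2 : √Real.pi = Real.pi ^ ((1 : ℝ) / 4) * Real.pi ^ ((1 : ℝ) / 4) := by
      rw [← Real.rpow_add Real.pi_pos, Real.sqrt_eq_rpow]
      norm_num
    rw [h1, h2, mul_inv, hermite1D, hermiteNorm]
    simp [physHermite]
    ring
  simp_rw [h, integral_const_mul, integral_gaussian]
  have : √Real.pi ≠ 0 := by
    have := Real.pi_pos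
    positivity
  simp [this]

lemma integral_hermite1D_mul (j k : ℕ) :
    ∫ t, hermite1D j t * hermite1D k t = if j = k then 1 else 0 := by
  induction j generalizing k with
  | zero =>
    cases k with
    | zero => simpa using integral_hermite1D_zero
    | succ k =>
      -- With second index 0 the right side of the ladder carries √0, so the integral of h_(k+1) h_0
      -- vanishes.
      have h := integral_hermite1D_ladder k 0
      simp only [CharP.cast_eq_zero, mul_zero, Real.sqrt_zero, zero_mul, mul_eq_zero] at h
      have h0 : √(2 * ((k : ℝ) + 1)) ≠ 0 := by positivity
      simpa [mul_comm] using h.resolve_left h0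
  | succ j ih =>
    have h := integral_hermite1D_ladder j k
    have h0 : √(2 * ((j : ℝ) + 1)) ≠ 0 := by positivity
    cases k with
    | zero =>
      simp only [CharP.cast_eq_zero, mul_zero, Real.sqrt_zero, zero_mul, mul_eq_zero] at h
      simpa using h.resolve_left h0
    | succ k =>
      rw [Nat.add_sub_cancel, ih k] at h
      by_cases hjk : j = k
      · subst hjk
        push_cast at h
        simpa using mul_left_cancel₀ h0 h
      · simp only [hjk, if_false, mul_zero, mul_eq_zero] at h
        simpa [hjk] using h.resolve_left h0

/-- h_k² is the integral of 2·h_k·h_k' from -∞. Since h_k' is a combination of h_(k-1) and h_(k+1),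
the integrand is at most a combination `G` of squares, whose integral is 1 + k + (k + 1) by
orthonormality. -/
lemma abs_hermite1D_le (k : ℕ) (t : ℝ) : |hermite1D k t| ≤ 2 * ((k : ℝ) + 1) := by
  set d : ℝ → ℝ := fun t =>
    (√(2 * (k : ℝ)) * hermite1D (k - 1) t - √(2 * ((k : ℝ) + 1)) * hermite1D (k + 1) t) / 2
  have hd : ∀ t, HasDerivAt (hermite1D k) (d t) t := fun t => by
    refine (hasDerivAt_hermite1D k t).congr_deriv ?_
    simp only [d]
    linear_combination - (1 / 2) * two_mul_mul_hermite1D k t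
  set f' : ℝ → ℝ := fun t => d t * hermite1D k t + hermite1D k t * d t
  have hf : ∀ t, HasDerivAt (fun t => hermite1D k t * hermite1D k t) (f' t) t :=
    fun t => (hd t).mul (hd t)
  have hf'i : Integrable f' := by
    have := ((integrable_hermite1D_mul_hermite1D (k - 1) k).const_mul √(2 * (k : ℝ))).sub
      ((integrable_hermite1D_mul_hermite1D (k + 1) k).const_mul √(2 * ((k : ℝ) + 1)))
    refine this.congr (.of_forall fun t => ?_)
    simp only [f', d, Pi.sub_apply]
    ring
  set G : ℝ → ℝ := fun t => hermite1D k t * hermite1D k t +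
    (k * (hermite1D (k - 1) t * hermite1D (k - 1) t) +
      (k + 1) * (hermite1D (k + 1) t * hermite1D (k + 1) t))
  have h1 := (integrable_hermite1D_mul_hermite1D (k - 1) (k - 1)).const_mul (k : ℝ)
  have h2 := (integrable_hermite1D_mul_hermite1D (k + 1) (k + 1)).const_mul ((k : ℝ) + 1)
  have h3 := integrable_hermite1D_mul_hermite1D k k
  have hGi : Integrable G := h3.add (h1.add h2)
  have hGv : ∫ t, G t = 2 * ((k : ℝ) + 1) := by
    simp only [G]
    rw [integral_add h3 (h1.fun_add h2), integral_add h1 h2, integral_const_mul, integral_const_mul]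
    simp only [integral_hermite1D_mul]
    simp
    ring
  have hle : ∀ t, f' t ≤ G t := fun t => by
    simp only [f', G, d]
    have e1 : √(2 * (k : ℝ)) ^ 2 = 2 * (k : ℝ) := Real.sq_sqrt (by positivity)
    have e2 : √(2 * ((k : ℝ) + 1)) ^ 2 = 2 * ((k : ℝ) + 1) := Real.sq_sqrt (by positivity)
    have e3 : (k : ℝ) * (hermite1D (k - 1) t * hermite1D (k - 1) t) =
        (√(2 * (k : ℝ)) * hermite1D (k - 1) t) ^ 2 / 2 := by
      rw [mul_pow, e1]
      ring
    have e4 : ((k : ℝ) + 1) * (hermite1D (k + 1) t * hermite1D (k + 1) t) =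
        (√(2 * ((k : ℝ) + 1)) * hermite1D (k + 1) t) ^ 2 / 2 := by
      rw [mul_pow, e2]
      ring
    rw [e3, e4]
    generalize √(2 * (k : ℝ)) * hermite1D (k - 1) t = a
    generalize √(2 * ((k : ℝ) + 1)) * hermite1D (k + 1) t = b
    -- With h = h_k and h' = (a - b)/2: 2hh' ≤ h² + (a - b)²/4 ≤ h² + (a² + b²)/2.
    nlinarith [sq_nonneg (hermite1D k t - (a - b) / 2), sq_nonneg (a + b)]
  have hG0 : ∀ t, 0 ≤ G t := fun t => by
    have : ∀ x : ℝ, 0 ≤ x * x := mul_self_nonneg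
    simp only [G]
    have := this (hermite1D k t)
    have := mul_nonneg k.cast_nonneg (mul_self_nonneg (hermite1D (k - 1) t))
    have := mul_nonneg (by positivity : (0 : ℝ) ≤ k + 1) (mul_self_nonneg (hermite1D (k + 1) t))
    linarith
  have hI := integral_Iic_of_hasDerivAt_of_tendsto' (a := t) (fun x _ => hf x) hf'i.integrableOn
    (tendsto_zero_of_hasDerivAt_of_integrableOn_Iic (a := t) (fun x _ => hf x) hf'i.integrableOn
      h3.integrableOn)
  have hfin : hermite1D k t * hermite1D k t ≤ 2 * ((k : ℝ) + 1) := by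
    rw [sub_zero] at hI
    rw [← hI, ← hGv]
    refine (setIntegral_mono hf'i.integrableOn hGi.integrableOn hle).trans
      (setIntegral_le_integral hGi (.of_forall hG0))
  have hk : (0 : ℝ) ≤ k := k.cast_nonneg
  -- The square root is given away, as 2(k + 1) ≤ (2(k + 1))²: only polynomial growth matters.
  refine abs_le_of_sq_le_sq ?_ (by positivity)
  nlinarith

/-- The three-term recurrence trades each factor t for a shift of the index by one, at the cost of
one more power of k + 1. -/
lemma abs_pow_mul_hermite1D_le (m : ℕ) : ∃ C : ℝ, 0 ≤ C ∧ ∀ (k : ℕ) (t : ℝ),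
    |t| ^ m * |hermite1D k t| ≤ C * ((k : ℝ) + 1) ^ (m + 1) := by
  induction m with
  | zero => exact ⟨2, by norm_num, fun k t => by simpa using abs_hermite1D_le k t⟩
  | succ m ih =>
    obtain ⟨C, hC, h⟩ := ih
    refine ⟨C * 2 ^ (m + 2), by positivity, fun k t => ?_⟩
    have hk : (0 : ℝ) ≤ k := k.cast_nonneg
    have hs : ∀ x : ℝ, 0 ≤ x → x ≤ k + 1 → √(2 * x) ≤ 2 * (k + 1) := fun x hx hxk => by
      refine Real.sqrt_le_iff.2 ⟨by positivity, ?_⟩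
      nlinarith
    have e := congrArg abs (two_mul_mul_hermite1D k t)
    rw [abs_mul, abs_mul, abs_two] at e
    have e2 := e.le.trans (abs_add_le _ _)
    rw [abs_mul, abs_mul, abs_of_nonneg (Real.sqrt_nonneg _), abs_of_nonneg (Real.sqrt_nonneg _)] at e2
    have hb1 : |t| ^ m * |hermite1D (k - 1) t| ≤ C * (2 * ((k : ℝ) + 1)) ^ (m + 1) := by
      refine (h _ t).trans ?_
      have : ((k - 1 : ℕ) : ℝ) ≤ k := by exact_mod_cast Nat.sub_le _ _
      gcongr
      linarith
    have hb2 : |t| ^ m * |hermite1D (k + 1) t| ≤ C * (2 * ((k : ℝ) + 1)) ^ (m + 1) := by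
      refine (h _ t).trans ?_
      push_cast
      gcongr
      linarith
    have h1 := hs k hk (by linarith)
    have h2 := hs (k + 1) (by linarith) le_rfl
    calc |t| ^ (m + 1) * |hermite1D k t| = |t| ^ m * (2 * |t| * |hermite1D k t|) / 2 := by ring
      _ ≤ |t| ^ m * (√(2 * (k : ℝ)) * |hermite1D (k - 1) t| +
            √(2 * ((k : ℝ) + 1)) * |hermite1D (k + 1) t|) / 2 := by gcongr
      _ = (√(2 * (k : ℝ)) * (|t| ^ m * |hermite1D (k - 1) t|) +
            √(2 * ((k : ℝ) + 1)) * (|t| ^ m * |hermite1D (k + 1) t|)) / 2 := by ring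
      _ ≤ (2 * (k + 1) * (C * (2 * ((k : ℝ) + 1)) ^ (m + 1)) +
            2 * (k + 1) * (C * (2 * ((k : ℝ) + 1)) ^ (m + 1))) / 2 := by gcongr
      _ = C * 2 ^ (m + 2) * ((k : ℝ) + 1) ^ (m + 1 + 1) := by
        rw [mul_pow]
        ring

/-! ### Hermite functions of several variables as products -/

variable {n : ℕ}

lemma hasLineDerivAt_prod (F : Fin n → ℝ → ℝ) (i : Fin n) (x : Rn n) {d : ℝ}
    (h : HasDerivAt (F i) d (x i)) :
    HasLineDerivAt ℝ (fun x : Rn n => ∏ j, F j (x j))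
      (d * ∏ j ∈ Finset.univ.erase i, F j (x j)) x (EuclideanSpace.single i 1) := by
  have e : (fun t : ℝ => ∏ j, F j ((x + t • EuclideanSpace.single i (1 : ℝ)) j)) =
      fun t => F i (x i + t) * ∏ j ∈ Finset.univ.erase i, F j (x j) := by
    funext t
    rw [← Finset.mul_prod_erase _ _ (Finset.mem_univ i)]
    congr 1
    · simp
    · refine Finset.prod_congr rfl fun j hj => ?_
      simp [Finset.ne_of_mem_erase hj]
  unfold HasLineDerivAt
  rw [e]
  refine HasDerivAt.mul_const ?_ _
  have h' : HasDerivAt (F i) d (x i + 0) := by simpa using h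
  simpa using h'.comp_const_add (x i) 0

lemma prod_add_single (G : ℕ → ℝ → ℝ) (α : Fin n → ℕ) (i : Fin n) (k : ℕ) (x : Rn n) :
    ∏ j, G ((α + Pi.single i k : Fin n → ℕ) j) (x j) =
      G (α i + k) (x i) * ∏ j ∈ Finset.univ.erase i, G (α j) (x j) := by
  rw [← Finset.mul_prod_erase _ _ (Finset.mem_univ i)]
  congr 1
  · simp
  · refine Finset.prod_congr rfl fun j hj => ?_
    simp [Finset.ne_of_mem_erase hj]

lemma prod_sub_single (G : ℕ → ℝ → ℝ) (α : Fin n → ℕ) (i : Fin n) (k : ℕ) (x : Rn n) :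
    ∏ j, G ((α - Pi.single i k : Fin n → ℕ) j) (x j) =
      G (α i - k) (x i) * ∏ j ∈ Finset.univ.erase i, G (α j) (x j) := by
  rw [← Finset.mul_prod_erase _ _ (Finset.mem_univ i)]
  congr 1
  · simp
  · refine Finset.prod_congr rfl fun j hj => ?_
    simp [Finset.ne_of_mem_erase hj]

/-- The `k`-th derivative of `e^(-t²)`. -/
def gaussDeriv (k : ℕ) (t : ℝ) : ℝ := (-1) ^ k * (physHermite k).eval t * Real.exp (-t ^ 2)

lemma iterate_pderiv_prod (i : Fin n) (k : ℕ) (f : Fin n → ℕ) :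
    (pderiv i)^[k] (fun x : Rn n => ∏ j, gaussDeriv (f j) (x j)) =
      fun x : Rn n => ∏ j, gaussDeriv ((f + Pi.single i k : Fin n → ℕ) j) (x j) := by
  induction k with
  | zero => simp
  | succ k ih =>
    rw [Function.iterate_succ_apply', ih]
    funext x
    have h : HasDerivAt (gaussDeriv ((f + Pi.single i k : Fin n → ℕ) i))
        (gaussDeriv ((f + Pi.single i k : Fin n → ℕ) i + 1) (x i)) (x i) :=
      hasDerivAt_physHermite_mul_exp _ _
    have h2 := (hasLineDerivAt_prod (fun j => gaussDeriv ((f + Pi.single i k : Fin n → ℕ) j))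
      i x h).lineDeriv
    rw [pderiv, h2, ← prod_add_single gaussDeriv, add_assoc, ← Pi.single_add]

lemma exp_neg_mul_norm_sq (b : ℝ) (x : Rn n) :
    Real.exp (-(b * ‖x‖ ^ 2)) = ∏ j, Real.exp (-(b * x j ^ 2)) := by
  rw [← Real.exp_sum, EuclideanSpace.real_norm_sq_eq, Finset.sum_neg_distrib, Finset.mul_sum]

lemma mderiv_gauss_eq_prod (α : Fin n → ℕ) (x : Rn n) :
    mderiv α (fun y => Real.exp (-‖y‖ ^ 2)) x =
      ∏ j, gaussDeriv (α j) (x j) := by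
  -- Generalised to partial lists: only the coordinates in `l` have been differentiated so far, each
  -- once because `l` has no duplicates.
  have key : ∀ l : List (Fin n), l.Nodup →
      l.foldr (fun i g => (pderiv i)^[α i] g) (fun y : Rn n => Real.exp (-‖y‖ ^ 2)) =
        fun x : Rn n => ∏ j, gaussDeriv (if j ∈ l then α j else 0) (x j) := by
    intro l hl
    induction l with
    | nil =>
      funext y
      have := exp_neg_mul_norm_sq 1 y
      simpa [physHermite, gaussDeriv] using this
    | cons i l ih =>
      rw [List.foldr_cons, ih (List.nodup_cons.1 hl).2, iterate_pderiv_prod]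
      have hi := (List.nodup_cons.1 hl).1
      have : (fun j => if j ∈ l then α j else 0) + Pi.single i (α i) =
          fun j => if j ∈ i :: l then α j else 0 := by
        funext j
        by_cases hj : j = i
        · subst hj
          simp [hi]
        · simp [hj]
      rw [this]
  unfold mderiv
  rw [key _ (List.nodup_finRange n)]
  simp

lemma prod_hermiteNorm (α : Fin n → ℕ) :
    ∏ j, hermiteNorm (α j) =
      Real.pi ^ ((n : ℝ) / 4) * 2 ^ ((mlen α : ℝ) / 2) * √(mfact α : ℝ) := by
  unfold hermiteNorm
  rw [Finset.prod_mul_distrib, Finset.prod_mul_distrib]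
  congr 1
  · congr 1
    · rw [Finset.prod_const, Finset.card_univ, Fintype.card_fin, ← Real.rpow_natCast,
        ← Real.rpow_mul Real.pi_pos.le]
      ring_nf
    · rw [← Real.rpow_sum_of_pos (by norm_num), ← Finset.sum_div]
      simp [mlen]
  · rw [mfact, ← Real.sqrt_prod _ (fun _ _ => Nat.cast_nonneg _)]
    push_cast
    rfl

/-- The sign (-1)^|α| of the definition cancels the one from differentiating the Gaussian, and
e^(x²/2)·e^(-x²) = e^(-x²/2) in each coordinate. -/
lemma hermiteFn_eq_prod (α : Fin n → ℕ) (x : Rn n) :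
    hermiteFn α x = ∏ j, hermite1D (α j) (x j) := by
  have h1 : Real.exp (‖x‖ ^ 2 / 2) = ∏ j, Real.exp (x j ^ 2 / 2) := by
    rw [← Real.exp_sum, EuclideanSpace.real_norm_sq_eq, Finset.sum_div]
  have h2 : (-1 : ℝ) ^ mlen α = ∏ j, (-1) ^ α j := by
    rw [Finset.prod_pow_eq_pow_sum, mlen]
  rw [hermiteFn, mderiv_gauss_eq_prod, ← prod_hermiteNorm, h1, h2, ← Finset.prod_div_distrib,
    ← Finset.prod_mul_distrib, ← Finset.prod_mul_distrib]
  refine Finset.prod_congr rfl fun j _ => ?_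
  have h3 : (-1 : ℝ) ^ α j * (-1) ^ α j = 1 := by rw [← mul_pow]; simp
  have h4 : Real.exp (x j ^ 2 / 2) * Real.exp (-x j ^ 2) = Real.exp (-(x j ^ 2 / 2)) := by
    rw [← Real.exp_add]
    ring_nf
  rw [hermite1D, gaussDeriv, ← h4]
  linear_combination (hermiteNorm (α j))⁻¹ * Real.exp (x j ^ 2 / 2) *
    (physHermite (α j)).eval (x j) * Real.exp (-x j ^ 2) * h3

lemma hermite_apply (α : Fin n → ℕ) (x : Rn n) : hermite α x = (hermiteFn α x : ℂ) := rfl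

lemma two_mul_mul_hermiteFn (α : Fin n → ℕ) (i : Fin n) (x : Rn n) :
    2 * x i * hermiteFn α x = √(2 * (α i : ℝ)) * hermiteFn (α - Pi.single i 1) x +
      √(2 * ((α i : ℝ) + 1)) * hermiteFn (α + Pi.single i 1) x := by
  rw [hermiteFn_eq_prod (α + _), hermiteFn_eq_prod (α - _), prod_add_single, prod_sub_single,
    hermiteFn_eq_prod α, ← Finset.mul_prod_erase _ _ (Finset.mem_univ i), ← mul_assoc,
    two_mul_mul_hermite1D]
  ring

lemma lineDerivOp_hermite (α : Fin n → ℕ) (i : Fin n) (x : Rn n) :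
    ∂_{(EuclideanSpace.single i 1 : Rn n)} (hermite α) x =
      -(x i * hermite α x) + √(2 * (α i : ℝ)) * hermite (α - Pi.single i 1) x := by
  have h := hasLineDerivAt_prod (fun j => hermite1D (α j)) i x (hasDerivAt_hermite1D (α i) (x i))
  have h' : HasLineDerivAt ℝ (hermite α) _ x (EuclideanSpace.single i 1) :=
    (HasDerivAt.ofReal_comp h).congr_deriv rfl |>.congr_of_eventuallyEq
      (.of_forall fun t => by simp [hermite_apply, hermiteFn_eq_prod])
  rw [SchwartzMap.lineDerivOp_apply, h'.lineDeriv]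
  simp only [hermite_apply]
  rw [hermiteFn_eq_prod (α - _), prod_sub_single, hermiteFn_eq_prod α,
    ← Finset.mul_prod_erase _ (fun j => hermite1D (α j) (x j)) (Finset.mem_univ i)]
  push_cast
  ring

lemma lineDerivOp_hermite' (α : Fin n → ℕ) (i : Fin n) (x : Rn n) :
    ∂_{(EuclideanSpace.single i 1 : Rn n)} (hermite α) x =
      x i * hermite α x - √(2 * ((α i : ℝ) + 1)) * hermite (α + Pi.single i 1) x := by
  rw [lineDerivOp_hermite]
  have h := congrArg (fun t : ℝ => (t : ℂ)) (two_mul_mul_hermiteFn α i x)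
  push_cast at h
  simp only [hermite_apply]
  linear_combination -h

lemma integral_hermiteFn_mul (α β : Fin n → ℕ) :
    ∫ x, hermiteFn α x * hermiteFn β x = if α = β then 1 else 0 := by
  simp_rw [hermiteFn_eq_prod, ← Finset.prod_mul_distrib]
  have h := (PiLp.volume_preserving_ofLp (Fin n)).integral_comp
    (MeasurableEquiv.toLp 2 (Fin n → ℝ)).symm.measurableEmbedding
    (fun y : Fin n → ℝ => ∏ j, hermite1D (α j) (y j) * hermite1D (β j) (y j))
  refine h.trans ?_
  rw [integral_fintype_prod_volume_eq_prod
    (fun j t => hermite1D (α j) t * hermite1D (β j) t)]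
  simp_rw [integral_hermite1D_mul]
  split_ifs with hab
  · simp [hab]
  · obtain ⟨j, hj⟩ := Function.ne_iff.1 hab
    exact Finset.prod_eq_zero (Finset.mem_univ j) (by simp [hj])

/-! ### Polynomial growth of the Hermite functions in the index -/

/-- The weights in which Hermite functions grow polynomially. -/
def mweight (α : Fin n → ℕ) : ℝ := ∏ i, ((α i : ℝ) + 1)

lemma one_le_mweight (α : Fin n → ℕ) : 1 ≤ mweight α :=
  Finset.one_le_prod (fun i => by simp)

lemma mweight_pos (α : Fin n → ℕ) : 0 < mweight α := one_pos.trans_le (one_le_mweight α)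

lemma abs_hermiteFn_le (m : ℕ) : ∃ C : ℝ, 0 ≤ C ∧ ∀ (α : Fin n → ℕ) (x : Rn n),
    (1 + ‖x‖) ^ m * |hermiteFn α x| ≤ C * mweight α ^ (m + 1) := by
  obtain ⟨A, hA, hA'⟩ := abs_pow_mul_hermite1D_le 0
  obtain ⟨B, hB, hB'⟩ := abs_pow_mul_hermite1D_le m
  have h1 : ∀ (k : ℕ) (t : ℝ), (1 + |t|) ^ m * |hermite1D k t| ≤
      2 ^ m * (A + B) * ((k : ℝ) + 1) ^ (m + 1) := fun k t => by
    have hk : (1 : ℝ) ≤ k + 1 := by simp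
    have e : (1 + |t|) ^ m ≤ 2 ^ m * (1 + |t| ^ m) := by
      have := add_pow_le (zero_le_one) (abs_nonneg t) m
      rw [one_pow] at this
      refine this.trans ?_
      gcongr
      · norm_num
      · omega
    calc (1 + |t|) ^ m * |hermite1D k t| ≤ 2 ^ m * (1 + |t| ^ m) * |hermite1D k t| := by gcongr
      _ = 2 ^ m * (|t| ^ 0 * |hermite1D k t| + |t| ^ m * |hermite1D k t|) := by ring
      _ ≤ 2 ^ m * (A * ((k : ℝ) + 1) ^ (0 + 1) + B * ((k : ℝ) + 1) ^ (m + 1)) := by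
        exact mul_le_mul_of_nonneg_left (add_le_add (hA' k t) (hB' k t)) (by positivity)
      _ ≤ 2 ^ m * (A * ((k : ℝ) + 1) ^ (m + 1) + B * ((k : ℝ) + 1) ^ (m + 1)) := by
        have := pow_le_pow_right₀ hk (by omega : 0 + 1 ≤ m + 1)
        gcongr
      _ = _ := by ring
  refine ⟨(2 ^ m * (A + B)) ^ n, by positivity, fun α x => ?_⟩
  -- This comparison splits the weight over the coordinates, so the estimate factors into
  -- one-dimensional ones.
  have h2 : 1 + ‖x‖ ≤ ∏ j, (1 + |x j|) := by
    have h3 : ‖x‖ ≤ ∑ j, |x j| := by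
      rw [EuclideanSpace.norm_eq]
      refine (Real.sqrt_le_sqrt (Finset.sum_sq_le_sq_sum_of_nonneg (fun j _ => norm_nonneg _))).trans ?_
      rw [Real.sqrt_sq (Finset.sum_nonneg fun j _ => norm_nonneg _)]
      rfl
    refine (by gcongr : 1 + ‖x‖ ≤ 1 + ∑ j, |x j|).trans ?_
    induction (Finset.univ : Finset (Fin n)) using Finset.induction_on with
    | empty => simp
    | insert j s hj ih =>
      rw [Finset.sum_insert hj, Finset.prod_insert hj]
      have hs : 0 ≤ ∑ j ∈ s, |x j| := Finset.sum_nonneg fun j _ => abs_nonneg _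
      nlinarith [abs_nonneg (x j)]
  calc (1 + ‖x‖) ^ m * |hermiteFn α x| ≤ (∏ j, (1 + |x j|)) ^ m * |hermiteFn α x| := by gcongr
    _ = ∏ j, ((1 + |x j|) ^ m * |hermite1D (α j) (x j)|) := by
      rw [hermiteFn_eq_prod, Finset.abs_prod, Finset.prod_mul_distrib, Finset.prod_pow]
    _ ≤ ∏ j, (2 ^ m * (A + B) * ((α j : ℝ) + 1) ^ (m + 1)) :=
      Finset.prod_le_prod (fun j _ => by positivity) (fun j _ => h1 _ _)
    _ = _ := by
      rw [Finset.prod_mul_distrib, Finset.prod_pow, mweight]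
      simp

/-! ### Rapid decay of the Hermite coefficients of Schwartz functions -/

/-- The pairing of a Schwartz function with a Hermite function. -/
def coeff (α : Fin n → ℕ) (φ : 𝓢(Rn n, ℂ)) : ℂ := ∫ x, φ x * hermite α x

lemma integrable_schwartz_mul (φ ψ : 𝓢(Rn n, ℂ)) : Integrable fun x => φ x * ψ x :=
  φ.integrable.mul_bdd ψ.continuous.aestronglyMeasurable
    (.of_forall fun x => SchwartzMap.norm_le_seminorm ℂ ψ x)

/-- Multiplication by the `i`-th coordinate on the Schwartz class. -/
def mulCoord (i : Fin n) (φ : 𝓢(Rn n, ℂ)) : 𝓢(Rn n, ℂ) :=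
  SchwartzMap.smulLeftCLM ℂ (fun x : Rn n => inner ℝ (EuclideanSpace.single i (1 : ℝ)) x) φ

lemma mulCoord_apply (i : Fin n) (φ : 𝓢(Rn n, ℂ)) (x : Rn n) : mulCoord i φ x = x i * φ x := by
  rw [mulCoord, SchwartzMap.smulLeftCLM_apply_apply (Function.hasTemperateGrowth_inner_right _),
    EuclideanSpace.inner_single_left]
  simp

/-- The lowering operator `x_i + ∂_i`. -/
def lower (i : Fin n) (φ : 𝓢(Rn n, ℂ)) : 𝓢(Rn n, ℂ) :=
  mulCoord i φ + ∂_{(EuclideanSpace.single i 1 : Rn n)} φ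

/-- The raising operator `x_i - ∂_i`. -/
def raise (i : Fin n) (φ : 𝓢(Rn n, ℂ)) : 𝓢(Rn n, ℂ) :=
  mulCoord i φ - ∂_{(EuclideanSpace.single i 1 : Rn n)} φ

lemma integral_lineDerivOp_mul (i : Fin n) (φ ψ : 𝓢(Rn n, ℂ)) :
    ∫ x, ∂_{(EuclideanSpace.single i 1 : Rn n)} φ x * ψ x =
      -∫ x, φ x * ∂_{(EuclideanSpace.single i 1 : Rn n)} ψ x := by
  rw [SchwartzMap.integral_mul_lineDerivOp_right_eq_neg_left, neg_neg]

/-- Integration by parts moves x_i + ∂_i onto h_α as x_i - ∂_i, which raises the index. -/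
lemma coeff_lower (α : Fin n → ℕ) (i : Fin n) (φ : 𝓢(Rn n, ℂ)) :
    coeff α (lower i φ) = √(2 * ((α i : ℝ) + 1)) * coeff (α + Pi.single i 1) φ := by
  have h1 : coeff α (lower i φ) = (∫ x, mulCoord i φ x * hermite α x) +
      ∫ x, ∂_{(EuclideanSpace.single i 1 : Rn n)} φ x * hermite α x := by
    rw [← integral_add (integrable_schwartz_mul _ _) (integrable_schwartz_mul _ _)]
    refine integral_congr_ae (.of_forall fun x => ?_)
    simp [lower, add_mul]
  rw [h1, integral_lineDerivOp_mul, ← sub_eq_add_neg,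
    ← integral_sub (integrable_schwartz_mul _ _) (integrable_schwartz_mul _ _), coeff,
    ← integral_const_mul]
  refine integral_congr_ae (.of_forall fun x => ?_)
  simp only [lineDerivOp_hermite', mulCoord_apply]
  ring

lemma coeff_raise (α : Fin n → ℕ) (i : Fin n) (φ : 𝓢(Rn n, ℂ)) :
    coeff (α + Pi.single i 1) (raise i φ) = √(2 * ((α i : ℝ) + 1)) * coeff α φ := by
  have h1 : coeff (α + Pi.single i 1) (raise i φ) =
      (∫ x, mulCoord i φ x * hermite (α + Pi.single i 1) x) -
      ∫ x, ∂_{(EuclideanSpace.single i 1 : Rn n)} φ x * hermite (α + Pi.single i 1) x := by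
    rw [← integral_sub (integrable_schwartz_mul _ _) (integrable_schwartz_mul _ _)]
    refine integral_congr_ae (.of_forall fun x => ?_)
    simp [raise, sub_mul]
  rw [h1, integral_lineDerivOp_mul, sub_neg_eq_add,
    ← integral_add (integrable_schwartz_mul _ _) (integrable_schwartz_mul _ _), coeff,
    ← integral_const_mul]
  refine integral_congr_ae (.of_forall fun x => ?_)
  simp only [lineDerivOp_hermite, mulCoord_apply]
  have : α + Pi.single i 1 - Pi.single i 1 = α := by simp
  rw [this]
  simp
  ring

/-- The source of decay: multiplying the coefficients by 2(α_i + 1) yields the coefficients of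
another Schwartz function. Raising before lowering keeps this factor nonzero at α_i = 0. -/
lemma coeff_lower_raise (α : Fin n → ℕ) (i : Fin n) (φ : 𝓢(Rn n, ℂ)) :
    coeff α (lower i (raise i φ)) = 2 * ((α i : ℂ) + 1) * coeff α φ := by
  rw [coeff_lower, coeff_raise, ← mul_assoc, ← Complex.ofReal_mul,
    Real.mul_self_sqrt (by positivity)]
  push_cast
  ring

lemma norm_coeff_le (φ : 𝓢(Rn n, ℂ)) : ∃ C : ℝ, ∀ α, ‖coeff α φ‖ ≤ C * mweight α := by
  obtain ⟨A, hA, h⟩ := abs_hermiteFn_le (n := n) 0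
  refine ⟨A * ∫ x, ‖φ x‖, fun α => ?_⟩
  calc ‖coeff α φ‖ ≤ ∫ x, ‖φ x‖ * (A * mweight α) := by
        refine norm_integral_le_of_norm_le (φ.integrable.norm.mul_const _)
          (.of_forall fun x => ?_)
        rw [norm_mul, hermite_apply, Complex.norm_real]
        gcongr
        simpa using h α x
    _ = _ := by
      rw [integral_mul_const]
      ring

/-- Each application of `lower i ∘ raise i` gains a factor α_i + 1; the crude bound `norm_coeff_le`
is then used on the resulting Schwartz function. Both inductions therefore range over all φ. -/
lemma norm_coeff_mul_prod_le (N : ℕ) (s : Finset (Fin n)) (φ : 𝓢(Rn n, ℂ)) :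
    ∃ C : ℝ, ∀ α, ‖coeff α φ‖ * ∏ i ∈ s, ((α i : ℝ) + 1) ^ N ≤ C * mweight α := by
  induction s using Finset.induction_on generalizing φ with
  | empty => simpa using norm_coeff_le φ
  | insert i s hi ih =>
    have key : ∀ k : ℕ, ∀ φ : 𝓢(Rn n, ℂ), ∃ C : ℝ, ∀ α,
        ‖coeff α φ‖ * ((α i : ℝ) + 1) ^ k * ∏ i ∈ s, ((α i : ℝ) + 1) ^ N ≤ C * mweight α := by
      intro k
      induction k with
      | zero => simpa using ih
      | succ k ihk =>
        intro φ
        obtain ⟨C, hC⟩ := ihk (lower i (raise i φ))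
        refine ⟨C, fun α => le_trans ?_ (hC α)⟩
        have hn : ‖(2 : ℂ) * ((α i : ℂ) + 1)‖ = 2 * ((α i : ℝ) + 1) := by
          have : (2 : ℂ) * ((α i : ℂ) + 1) = ((2 * ((α i : ℝ) + 1) : ℝ) : ℂ) := by push_cast; rfl
          rw [this, Complex.norm_real, Real.norm_of_nonneg (by positivity)]
        rw [coeff_lower_raise, norm_mul, hn, pow_succ]
        have hp : 0 ≤ ‖coeff α φ‖ * ((α i : ℝ) + 1) ^ (k + 1) *
          ∏ i ∈ s, ((α i : ℝ) + 1) ^ N := by positivity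
        rw [pow_succ] at hp
        nlinarith
    obtain ⟨C, hC⟩ := key N φ
    refine ⟨C, fun α => ?_⟩
    rw [Finset.prod_insert hi, ← mul_assoc]
    exact hC α

/-- The Hermite coefficients of a Schwartz function decay rapidly. -/
lemma norm_coeff_mul_mweight_pow_le (N : ℕ) (φ : 𝓢(Rn n, ℂ)) :
    ∃ C : ℝ, 0 ≤ C ∧ ∀ α, ‖coeff α φ‖ ≤ C * (mweight α ^ N)⁻¹ := by
  obtain ⟨C, hC⟩ := norm_coeff_mul_prod_le (N + 1) Finset.univ φ
  refine ⟨max C 0, le_max_right _ _, fun α => ?_⟩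
  have hw := mweight_pos α
  have h := hC α
  rw [Finset.prod_pow] at h
  change _ * mweight α ^ (N + 1) ≤ _ at h
  rw [pow_succ, ← mul_assoc] at h
  rw [← div_eq_mul_inv, le_div_iff₀ (by positivity)]
  exact (le_of_mul_le_mul_right h hw).trans (le_max_left _ _)

lemma summable_mweight : Summable fun α : Fin n → ℕ => (mweight α ^ 2)⁻¹ := by
  have hs : Summable fun k : ℕ => (((k : ℝ) + 1) ^ 2)⁻¹ := by
    have := (summable_nat_add_iff 1).2 (Real.summable_nat_pow_inv.2 (by norm_num : 1 < 2))
    simpa using this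
  refine summable_of_sum_le (c := (∑' k : ℕ, (((k : ℝ) + 1) ^ 2)⁻¹) ^ n)
    (fun α => by have := mweight_pos α; positivity) fun u => ?_
  -- Every finite set of multi-indices lies in a box, over which the sum factors.
  set K : Fin n → Finset ℕ := fun i => u.image fun α => α i
  calc ∑ α ∈ u, (mweight α ^ 2)⁻¹ ≤ ∑ α ∈ Fintype.piFinset K, (mweight α ^ 2)⁻¹ := by
        refine Finset.sum_le_sum_of_subset_of_nonneg (fun α hα => ?_)
          (fun α _ _ => by have := mweight_pos α; positivity)
        rw [Fintype.mem_piFinset]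
        exact fun i => Finset.mem_image_of_mem _ hα
    _ = ∏ i, ∑ k ∈ K i, (((k : ℝ) + 1) ^ 2)⁻¹ := by
      rw [Finset.prod_univ_sum]
      refine Finset.sum_congr rfl fun α _ => ?_
      rw [mweight, ← Finset.prod_pow, Finset.prod_inv_distrib]
    _ ≤ ∏ _i : Fin n, ∑' k : ℕ, (((k : ℝ) + 1) ^ 2)⁻¹ :=
      Finset.prod_le_prod (fun i _ => Finset.sum_nonneg fun k _ => by positivity)
        (fun i _ => hs.sum_le_tsum _ (fun k _ => by positivity))
    _ = _ := by simp

/-! ### Completeness of the Hermite functions -/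

/-- The linear span of the Hermite functions. -/
def hermiteSpan (n : ℕ) : Submodule ℂ (Rn n → ℂ) :=
  Submodule.span ℂ (Set.range fun α => (hermite α : Rn n → ℂ))

lemma hermite_mem_hermiteSpan (α : Fin n → ℕ) : (hermite α : Rn n → ℂ) ∈ hermiteSpan n :=
  Submodule.subset_span ⟨α, rfl⟩

lemma coord_mul_mem_hermiteSpan (i : Fin n) {f : Rn n → ℂ} (hf : f ∈ hermiteSpan n) :
    (fun x => (x i : ℂ) * f x) ∈ hermiteSpan n := by
  refine Submodule.span_induction (p := fun f _ => (fun x => (x i : ℂ) * f x) ∈ hermiteSpan n)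
    ?_ ?_ ?_ ?_ hf
  · rintro _ ⟨α, rfl⟩
    have e : (fun x : Rn n => (x i : ℂ) * hermite α x) =
        ((√(2 * (α i : ℝ)) / 2 : ℝ) : ℂ) • (hermite (α - Pi.single i 1) : Rn n → ℂ) +
        ((√(2 * ((α i : ℝ) + 1)) / 2 : ℝ) : ℂ) • (hermite (α + Pi.single i 1) : Rn n → ℂ) := by
      funext x
      have h := congrArg (fun t : ℝ => (t : ℂ)) (two_mul_mul_hermiteFn α i x)
      push_cast at h
      simp only [hermite_apply, Pi.add_apply, Pi.smul_apply, smul_eq_mul]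
      push_cast
      linear_combination h / 2
    rw [e]
    exact add_mem (Submodule.smul_mem _ _ (hermite_mem_hermiteSpan _))
      (Submodule.smul_mem _ _ (hermite_mem_hermiteSpan _))
  · convert zero_mem (hermiteSpan n) using 1
    funext x
    simp
  · intro f g _ _ hf hg
    convert add_mem hf hg using 1
    funext x
    simp [mul_add]
  · intro a f _ hf
    convert Submodule.smul_mem _ a hf using 1
    funext x
    simp only [Pi.smul_apply, smul_eq_mul]
    ring

lemma inner_mul_mem_hermiteSpan (ξ : Rn n) {f : Rn n → ℂ} (hf : f ∈ hermiteSpan n) :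
    (fun x => ((inner ℝ x ξ : ℝ) : ℂ) * f x) ∈ hermiteSpan n := by
  have e : (fun x => ((inner ℝ x ξ : ℝ) : ℂ) * f x) =
      ∑ i, (ξ i : ℂ) • fun x : Rn n => (x i : ℂ) * f x := by
    funext x
    rw [PiLp.inner_apply, Finset.sum_apply]
    push_cast
    rw [Finset.sum_mul]
    refine Finset.sum_congr rfl fun i _ => ?_
    simp
    ring
  rw [e]
  exact sum_mem fun i _ => Submodule.smul_mem _ _ (coord_mul_mem_hermiteSpan i hf)

lemma gaussian_mem_hermiteSpan :
    (fun x : Rn n => (Real.exp (-(‖x‖ ^ 2 / 2)) : ℂ)) ∈ hermiteSpan n := by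
  have e : (fun x : Rn n => (Real.exp (-(‖x‖ ^ 2 / 2)) : ℂ)) =
      ((∏ _j : Fin n, hermiteNorm 0 : ℝ) : ℂ) • (hermite (0 : Fin n → ℕ) : Rn n → ℂ) := by
    funext x
    have h := exp_neg_mul_norm_sq (1 / 2) x
    rw [Pi.smul_apply, hermite_apply, smul_eq_mul, ← Complex.ofReal_mul, hermiteFn_eq_prod,
      ← Finset.prod_mul_distrib, show ‖x‖ ^ 2 / 2 = 1 / 2 * ‖x‖ ^ 2 by ring, h]
    congr 1
    refine Finset.prod_congr rfl fun j _ => ?_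
    have := (hermiteNorm_pos 0).ne'
    simp only [hermite1D, physHermite, Pi.zero_apply, Polynomial.eval_one]
    field_simp
  rw [e]
  exact Submodule.smul_mem _ _ (hermite_mem_hermiteSpan _)

/-- Up to constants, these are the terms of the exponential series of the Fourier kernel times the
Gaussian. -/
lemma inner_pow_mul_gaussian_mem_hermiteSpan (ξ : Rn n) (k : ℕ) :
    (fun x : Rn n => ((inner ℝ x ξ : ℝ) : ℂ) ^ k * (Real.exp (-(‖x‖ ^ 2 / 2)) : ℂ)) ∈
      hermiteSpan n := by
  induction k with
  | zero => simpa using gaussian_mem_hermiteSpan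
  | succ k ih =>
    convert inner_mul_mem_hermiteSpan ξ ih using 1
    funext x
    ring

lemma integral_mul_eq_zero_of_mem_hermiteSpan {g : Rn n → ℂ} (hg : Continuous g) {C : ℝ}
    (hC : ∀ x, ‖g x‖ ≤ C) (h0 : ∀ α, ∫ x, g x * hermite α x = 0) {f : Rn n → ℂ}
    (hf : f ∈ hermiteSpan n) : Integrable (fun x => g x * f x) ∧ ∫ x, g x * f x = 0 := by
  refine Submodule.span_induction
    (p := fun f _ => Integrable (fun x => g x * f x) ∧ ∫ x, g x * f x = 0) ?_ ?_ ?_ ?_ hf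
  · rintro _ ⟨α, rfl⟩
    exact ⟨(hermite α).integrable.bdd_mul hg.aestronglyMeasurable (.of_forall hC), h0 α⟩
  · simp
  · rintro f₁ f₂ _ _ ⟨hi₁, h₁⟩ ⟨hi₂, h₂⟩
    simp only [Pi.add_apply, mul_add]
    exact ⟨hi₁.add hi₂, by rw [integral_add hi₁ hi₂, h₁, h₂, add_zero]⟩
  · rintro a f _ ⟨hi, h⟩
    simp only [Pi.smul_apply, smul_eq_mul, mul_left_comm _ a]
    exact ⟨hi.const_mul a, by rw [integral_const_mul, h, mul_zero]⟩

lemma integrable_exp_mul_norm_mul_gaussian (c : ℝ) :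
    Integrable fun x : Rn n => Real.exp (c * ‖x‖) * Real.exp (-(‖x‖ ^ 2 / 2)) := by
  -- Since c‖x‖ ≤ c² + ‖x‖²/4, the integrand is at most e^(c²)·e^(-‖x‖²/4).
  have h := (GaussianFourier.integrable_cexp_neg_mul_sq_norm_add (V := Rn n) (b := 1 / 4)
    (by norm_num) 0 0).norm.const_mul (Real.exp (c ^ 2))
  refine h.mono' (by fun_prop) (.of_forall fun x => ?_)
  have e : (-(1 / 4 : ℂ) * (‖x‖ : ℂ) ^ 2 + 0 * ((inner ℝ (0 : Rn n) x : ℝ) : ℂ)) =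
      ((-(1 / 4) * ‖x‖ ^ 2 : ℝ) : ℂ) := by
    push_cast
    ring
  rw [e, ← Complex.ofReal_exp, Complex.norm_real, ← Real.exp_add, Real.norm_of_nonneg (by positivity),
    Real.norm_of_nonneg (by positivity), ← Real.exp_add]
  refine Real.exp_le_exp.2 ?_
  nlinarith [sq_nonneg (c - ‖x‖ / 2)]

/-- Dominated convergence: the absolute values of the terms are bounded by a series with sum
C·e^(c‖x‖)·e^(-‖x‖²/2), where c = 2π‖ξ‖, and this is integrable. -/
lemma hasSum_integral_fourier_series {g : Rn n → ℂ} (hg : Continuous g) {C : ℝ}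
    (hC : ∀ x, ‖g x‖ ≤ C) (ξ : Rn n) :
    HasSum (fun k : ℕ => ∫ x, (((-2 * Real.pi * inner ℝ x ξ : ℝ) : ℂ) * Complex.I) ^ k /
        k.factorial * (g x * (Real.exp (-(‖x‖ ^ 2 / 2)) : ℂ)))
      (∫ x, Complex.exp (((-2 * Real.pi * inner ℝ x ξ : ℝ) : ℂ) * Complex.I) •
        (g x * (Real.exp (-(‖x‖ ^ 2 / 2)) : ℂ))) := by
  have hz : ∀ x, ‖((-2 * Real.pi * inner ℝ x ξ : ℝ) : ℂ) * Complex.I‖ ≤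
      (2 * Real.pi * ‖ξ‖) * ‖x‖ := fun x => by
    simp only [norm_mul, Complex.norm_real, Complex.norm_I, mul_one, norm_neg,
      RCLike.norm_ofNat, Real.norm_of_nonneg Real.pi_pos.le]
    have := norm_inner_le_norm (𝕜 := ℝ) x ξ
    have := Real.pi_pos
    calc 2 * Real.pi * ‖inner ℝ x ξ‖ ≤ 2 * Real.pi * (‖x‖ * ‖ξ‖) := by gcongr
      _ = _ := by ring
  have hzc : Continuous fun x : Rn n => ((-2 * Real.pi * inner ℝ x ξ : ℝ) : ℂ) * Complex.I := by
    fun_prop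
  generalize hzdef : (fun x : Rn n => ((-2 * Real.pi * inner ℝ x ξ : ℝ) : ℂ) * Complex.I) = z at hzc
  have hzx : ∀ x, ((-2 * Real.pi * inner ℝ x ξ : ℝ) : ℂ) * Complex.I = z x := congrFun hzdef
  simp only [hzx] at hz ⊢
  generalize 2 * Real.pi * ‖ξ‖ = c at hz
  have hexp : ∀ x : Rn n, HasSum (fun k : ℕ => (c * ‖x‖) ^ k / k.factorial *
      (C * Real.exp (-(‖x‖ ^ 2 / 2)))) (Real.exp (c * ‖x‖) * (C * Real.exp (-(‖x‖ ^ 2 / 2)))) := by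
    intro x
    rw [congrFun Real.exp_eq_exp_ℝ (c * ‖x‖)]
    exact (NormedSpace.expSeries_div_hasSum_exp (c * ‖x‖)).mul_right _
  have hcexp : ∀ w : ℂ, HasSum (fun k : ℕ => w ^ k / k.factorial) (Complex.exp w) := fun w => by
    rw [Complex.exp_eq_exp_ℂ]
    exact NormedSpace.expSeries_div_hasSum_exp w
  refine hasSum_integral_of_dominated_convergence
    (fun k x => (c * ‖x‖) ^ k / k.factorial * (C * Real.exp (-(‖x‖ ^ 2 / 2)))) ?_ ?_ ?_ ?_ ?_
  · intro k
    refine Continuous.aestronglyMeasurable ?_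
    fun_prop
  · refine fun k => .of_forall fun x => ?_
    simp only [norm_mul, norm_div, norm_pow, Complex.norm_natCast, Complex.norm_real,
      Real.norm_of_nonneg (Real.exp_pos _).le]
    have := (norm_nonneg _).trans (hz x)
    gcongr
    · exact hz x
    · exact hC x
  · exact .of_forall fun x => (hexp x).summable
  · simp only [(hexp _).tsum_eq]
    refine ((integrable_exp_mul_norm_mul_gaussian c).const_mul C).congr (.of_forall fun x => ?_)
    simp only
    ring
  · exact .of_forall fun x => (hcexp (z x)).mul_right _

/-- A bounded continuous function orthogonal to all Hermite functions vanishes. -/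
lemma eq_zero_of_integral_mul_hermite_eq_zero {g : Rn n → ℂ} (hg : Continuous g) {C : ℝ}
    (hC : ∀ x, ‖g x‖ ≤ C) (h0 : ∀ α, ∫ x, g x * hermite α x = 0) : g = 0 := by
  set F : Rn n → ℂ := fun x => g x * (Real.exp (-(‖x‖ ^ 2 / 2)) : ℂ)
  have hFc : Continuous F := by fun_prop
  have hFi : Integrable F :=
    (integral_mul_eq_zero_of_mem_hermiteSpan hg hC h0 gaussian_mem_hermiteSpan).1
  have hF : FourierTransform.fourier F = 0 := by
    funext ξ
    rw [Real.fourier_eq', Pi.zero_apply]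
    exact (hasSum_integral_fourier_series hg hC ξ).unique (by
      have hzero : ∀ k : ℕ, ∫ x, (((-2 * Real.pi * inner ℝ x ξ : ℝ) : ℂ) * Complex.I) ^ k /
          k.factorial * F x = 0 := fun k => by
        have h := (integral_mul_eq_zero_of_mem_hermiteSpan hg hC h0
          (inner_pow_mul_gaussian_mem_hermiteSpan ξ k)).2
        have e : ∀ x, (((-2 * Real.pi * inner ℝ x ξ : ℝ) : ℂ) * Complex.I) ^ k /
            k.factorial * F x = ((-2 * Real.pi * Complex.I) ^ k / k.factorial) *
            (g x * (((inner ℝ x ξ : ℝ) : ℂ) ^ k * (Real.exp (-(‖x‖ ^ 2 / 2)) : ℂ))) := fun x => by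
          simp only [F]
          push_cast
          ring
        simp_rw [e]
        rw [integral_const_mul, h, mul_zero]
      simp only [F] at hzero
      simp only [hzero]
      exact hasSum_zero)
  -- Fourier inversion applies because the transform, being zero, is integrable; dividing by the
  -- positive Gaussian then gives g = 0.
  have hinv := hFc.fourierInv_fourier_eq hFi (by rw [hF]; exact integrable_zero _ _ _)
  rw [hF] at hinv
  funext x
  have hx := congrFun hinv x
  rw [Real.fourierInv_eq'] at hx
  simp only [Pi.zero_apply, smul_zero, integral_zero, F] at hx
  have he : (Real.exp (-(‖x‖ ^ 2 / 2)) : ℂ) ≠ 0 := by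
    exact_mod_cast (Real.exp_pos _).ne'
  exact (mul_eq_zero.1 hx.symm).resolve_right he

/-! ### Hermite series of Schwartz functions -/

lemma integral_hermite_mul_hermite (α β : Fin n → ℕ) :
    ∫ x, hermite α x * hermite β x = if α = β then 1 else 0 := by
  simp_rw [hermite_apply, ← Complex.ofReal_mul]
  rw [integral_complex_ofReal, integral_hermiteFn_mul]
  split_ifs <;> simp

lemma norm_coeff_mul_hermite_le (m : ℕ) (φ : 𝓢(Rn n, ℂ)) : ∃ C : ℝ, 0 ≤ C ∧ ∀ α x,
    (1 + ‖x‖) ^ m * ‖coeff α φ * hermite α x‖ ≤ C * (mweight α ^ 2)⁻¹ := by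
  obtain ⟨A, hA, h1⟩ := abs_hermiteFn_le (n := n) m
  -- Decay of order m + 3 absorbs the growth of order m + 1 and leaves the summable weight of order
  -- -2.
  obtain ⟨B, hB, h2⟩ := norm_coeff_mul_mweight_pow_le (m + 3) φ
  refine ⟨A * B, by positivity, fun α x => ?_⟩
  have hw := mweight_pos α
  rw [norm_mul, hermite_apply, Complex.norm_real, Real.norm_eq_abs]
  calc (1 + ‖x‖) ^ m * (‖coeff α φ‖ * |hermiteFn α x|)
      = ((1 + ‖x‖) ^ m * |hermiteFn α x|) * ‖coeff α φ‖ := by ring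
    _ ≤ (A * mweight α ^ (m + 1)) * (B * (mweight α ^ (m + 3))⁻¹) :=
      mul_le_mul (h1 α x) (h2 α) (norm_nonneg _) (by positivity)
    _ = A * B * (mweight α ^ 2)⁻¹ := by
      rw [show m + 3 = (m + 1) + 2 by ring, pow_add _ (m + 1) 2]
      field_simp

/-- A Schwartz function is the sum of its Hermite series, pointwise. -/
lemma hasSum_coeff_mul_hermite (φ : 𝓢(Rn n, ℂ)) (x : Rn n) :
    HasSum (fun α => coeff α φ * hermite α x) (φ x) := by
  obtain ⟨C, hC, hb⟩ := norm_coeff_mul_hermite_le 0 φ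
  simp only [pow_zero, one_mul] at hb
  have hsC : Summable fun α : Fin n → ℕ => C * (mweight α ^ 2)⁻¹ := summable_mweight.mul_left C
  have hs : ∀ x, Summable fun α => coeff α φ * hermite α x := fun x =>
    .of_norm_bounded hsC fun α => hb α x
  set S : Rn n → ℂ := fun x => ∑' α, coeff α φ * hermite α x
  have hSc : Continuous S :=
    continuous_tsum (fun α => continuous_const.mul (hermite α).continuous) hsC hb
  have hSb : ∀ x, ‖S x‖ ≤ ∑' α : Fin n → ℕ, C * (mweight α ^ 2)⁻¹ := fun x =>
    tsum_of_norm_bounded hsC.hasSum fun α => hb α x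
  have hSi : ∀ β, Integrable fun x => S x * hermite β x := fun β =>
    (hermite β).integrable.bdd_mul hSc.aestronglyMeasurable (.of_forall hSb)
  have hSβ : ∀ β, ∫ x, S x * hermite β x = coeff β φ := by
    intro β
    have h := hasSum_integral_of_dominated_convergence (μ := (volume : Measure (Rn n)))
      (F := fun α x => coeff α φ * hermite α x * hermite β x)
      (f := fun x => S x * hermite β x)
      (fun α x => C * (mweight α ^ 2)⁻¹ * ‖hermite β x‖)
      (fun α => ((continuous_const.mul (hermite α).continuous).mul
        (hermite β).continuous).aestronglyMeasurable)
      (fun α => .of_forall fun x => by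
        rw [norm_mul]
        exact mul_le_mul_of_nonneg_right (hb α x) (norm_nonneg _))
      (.of_forall fun x => hsC.mul_right _)
      (by
        simp only [tsum_mul_right]
        exact (hermite β).integrable.norm.const_mul _)
      (.of_forall fun x => (hs x).hasSum.mul_right _)
    refine h.unique ?_
    have e : (fun α => ∫ x, coeff α φ * hermite α x * hermite β x) =
        fun α => if α = β then coeff β φ else 0 := by
      funext α
      simp_rw [mul_assoc]
      rw [integral_const_mul, integral_hermite_mul_hermite]
      split_ifs with hab
      · simp [hab]
      · simp
    rw [e]
    exact hasSum_ite_eq β _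
  -- Only boundedness and continuity of the sum `S` are known, which is why completeness is stated
  -- for such functions.
  have hg := eq_zero_of_integral_mul_hermite_eq_zero (g := fun x => φ x - S x)
    (φ.continuous.sub hSc)
    (C := SchwartzMap.seminorm ℂ 0 0 φ + ∑' α : Fin n → ℕ, C * (mweight α ^ 2)⁻¹)
    (fun x => (norm_sub_le _ _).trans (add_le_add (SchwartzMap.norm_le_seminorm ℂ φ x) (hSb x)))
    (fun β => by
      simp_rw [sub_mul]
      rw [integral_sub (integrable_schwartz_mul _ _) (hSi β), hSβ, coeff, sub_self])
  have hx := sub_eq_zero.1 (congrFun hg x)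
  rw [hx]
  exact (hs x).hasSum

/-! ### The power of the norm as a tempered distribution -/

lemma integrable_norm_rpow_mul_inv_one_add_pow [Nontrivial (Rn n)] {s : ℝ} (hs : -(n : ℝ) < s) :
    ∃ k : ℕ, Integrable fun x : Rn n => ‖x‖ ^ s * ((1 + ‖x‖) ^ k)⁻¹ := by
  -- The radial integrand behaves like r^(n-1+s) near 0, integrable as s > -n, and like r^(n-1+s-k)
  -- at infinity, integrable as k > s + n.
  obtain ⟨k, hk⟩ := exists_nat_gt (s + n)
  refine ⟨k, ?_⟩
  rw [integrable_fun_norm_addHaar volume (f := fun r => r ^ s * ((1 + r) ^ k)⁻¹),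
    finrank_euclideanSpace_fin]
  have hn : 0 < n := by
    have := Module.finrank_pos (R := ℝ) (M := Rn n)
    rwa [finrank_euclideanSpace_fin] at this
  have hc : ((n - 1 : ℕ) : ℝ) = n - 1 := by
    rw [Nat.cast_sub hn, Nat.cast_one]
  have hm : Measurable fun y : ℝ => y ^ (n - 1) • (y ^ s * ((1 + y) ^ k)⁻¹) := by fun_prop
  have e : ∀ y : ℝ, 0 < y → ‖y ^ (n - 1) • (y ^ s * ((1 + y) ^ k)⁻¹)‖ =
      y ^ ((n : ℝ) - 1 + s) * ((1 + y) ^ k)⁻¹ := fun y hy => by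
    rw [Real.norm_of_nonneg (by positivity), Real.rpow_add hy, ← hc, Real.rpow_natCast, smul_eq_mul,
      mul_assoc]
  rw [← Set.Ioc_union_Ioi_eq_Ioi zero_le_one]
  refine IntegrableOn.union ?_ ?_
  · have h1 := (intervalIntegral.intervalIntegrable_rpow' (a := 0) (b := 1)
      (r := (n : ℝ) - 1 + s) (by linarith)).1
    refine Integrable.mono' h1 hm.aestronglyMeasurable ?_
    filter_upwards [ae_restrict_mem measurableSet_Ioc] with y hy
    rw [e y hy.1]
    refine mul_le_of_le_one_right (Real.rpow_nonneg hy.1.le _) (inv_le_one_of_one_le₀ ?_)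
    exact one_le_pow₀ (by linarith [hy.1])
  · have h1 := integrableOn_Ioi_rpow_of_lt (a := (n : ℝ) - 1 + s - k) (by linarith) one_pos
    refine Integrable.mono' h1 hm.aestronglyMeasurable ?_
    filter_upwards [ae_restrict_mem measurableSet_Ioi] with y hy
    have hy0 : 0 < y := one_pos.trans hy
    rw [e y hy0, Real.rpow_sub hy0, Real.rpow_natCast, div_eq_mul_inv]
    gcongr
    linarith

/-- Integrability of `‖x‖ ^ λ` against rapidly decaying functions, with a uniform bound. -/
lemma integrable_norm_cpow_mul [Nontrivial (Rn n)] {lam : ℂ} (hlam : -(n : ℝ) < lam.re) :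
    ∃ (k : ℕ) (I : ℝ), 0 ≤ I ∧ ∀ (f : Rn n → ℂ) (B : ℝ), Continuous f →
      (∀ x, (1 + ‖x‖) ^ k * ‖f x‖ ≤ B) → Integrable (fun x => (‖x‖ : ℂ) ^ lam * f x) ∧
        ∫ x, ‖(‖x‖ : ℂ) ^ lam * f x‖ ≤ B * I := by
  obtain ⟨k, hk⟩ := integrable_norm_rpow_mul_inv_one_add_pow hlam
  refine ⟨k, ∫ x : Rn n, ‖x‖ ^ lam.re * ((1 + ‖x‖) ^ k)⁻¹,
    integral_nonneg fun x => by positivity, fun f B hf hB => ?_⟩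
  have hle : ∀ᵐ x : Rn n, ‖(‖x‖ : ℂ) ^ lam * f x‖ ≤
      B * (‖x‖ ^ lam.re * ((1 + ‖x‖) ^ k)⁻¹) := by
    -- The origin is a null set; removing it avoids the conventional values of 0^λ.
    filter_upwards [compl_mem_ae_iff.2 (measure_singleton (0 : Rn n))] with x hx
    have hx0 : 0 < ‖x‖ := norm_pos_iff.2 hx
    rw [norm_mul, Complex.norm_cpow_eq_rpow_re_of_pos hx0, mul_left_comm]
    gcongr
    rw [← div_eq_mul_inv, le_div_iff₀' (by positivity)]
    exact hB x
  have hi : Integrable (fun x : Rn n => (‖x‖ : ℂ) ^ lam * f x) := by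
    refine (hk.const_mul B).mono' (AEStronglyMeasurable.mul ?_ hf.aestronglyMeasurable) hle
    exact ((Complex.measurable_ofReal.comp measurable_norm).pow_const lam).aestronglyMeasurable
  refine ⟨hi, ?_⟩
  rw [← integral_const_mul]
  exact integral_mono_ae hi.norm (hk.const_mul B) hle

/-- The function `‖x‖ ^ λ` is a tempered distribution for `Re λ > -n`. -/
lemma exists_isGivenBy_norm_cpow [Nontrivial (Rn n)] {lam : ℂ} (hlam : -(n : ℝ) < lam.re) :
    ∃ T : 𝓢'(Rn n, ℂ), IsGivenBy T fun x => (‖x‖ : ℂ) ^ lam := by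
  obtain ⟨k, I, hI, h⟩ := integrable_norm_cpow_mul hlam
  have hb : ∀ (φ : 𝓢(Rn n, ℂ)) (x : Rn n), (1 + ‖x‖) ^ k * ‖φ x‖ ≤
      2 ^ k * (Finset.Iic (k, 0)).sup (schwartzSeminormFamily ℂ (Rn n) ℂ) φ := fun φ x => by
    have := SchwartzMap.one_add_le_sup_seminorm_apply (𝕜 := ℂ) (m := (k, 0)) (k := k) (n := 0)
      le_rfl le_rfl φ x
    rwa [norm_iteratedFDeriv_zero] at this
  have hi := fun φ : 𝓢(Rn n, ℂ) => (h φ _ φ.continuous (hb φ)).1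
  refine ⟨ContinuousLinearMap.toPointwiseConvergenceCLM _ _ _ _
    (SchwartzMap.mkCLMtoNormedSpace (𝕜 := ℂ) (σ := RingHom.id ℂ)
      (fun φ : 𝓢(Rn n, ℂ) => ∫ x, (‖x‖ : ℂ) ^ lam * φ x) ?_ ?_ ?_),
    fun φ => ⟨hi φ, rfl⟩⟩
  · intro φ ψ
    simp only [add_apply, mul_add]
    exact integral_add (hi φ) (hi ψ)
  · intro a φ
    simp only [smul_apply, smul_eq_mul, mul_left_comm _ a]
    exact integral_const_mul _ _
  · refine ⟨Finset.Iic (k, 0), 2 ^ k * I, by positivity, fun φ => ?_⟩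
    refine (norm_integral_le_integral_norm _).trans ((h φ _ φ.continuous (hb φ)).2.trans_eq ?_)
    ring

/-! ### Hermite expansions of tempered distributions -/

lemma toTemperedDistributionCLM_hermite_apply (α : Fin n → ℕ) (φ : 𝓢(Rn n, ℂ)) :
    SchwartzMap.toTemperedDistributionCLM (Rn n) ℂ volume (hermite α) φ = coeff α φ :=
  SchwartzMap.toTemperedDistributionCLM_apply_apply volume (hermite α) φ

/-- The topology on tempered distributions is that of pointwise convergence, so summability is
tested on one Schwartz function at a time. -/
lemma isHermiteExpansion_iff {T : 𝓢'(Rn n, ℂ)} {a : (Fin n → ℕ) → ℂ} :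
    IsHermiteExpansion T a ↔ ∀ φ, HasSum (fun α => a α * coeff α φ) (T φ) := by
  unfold IsHermiteExpansion HasSum
  rw [PointwiseConvergenceCLM.tendsto_iff_forall_tendsto]
  refine forall_congr' fun φ => ?_
  have e : ∀ s : Finset (Fin n → ℕ), (∑ α ∈ s, a α •
      SchwartzMap.toTemperedDistributionCLM (Rn n) ℂ volume (hermite α)) φ =
      ∑ α ∈ s, a α * coeff α φ := fun s => by
    have := map_sum (PointwiseConvergenceCLM.evalCLM (RingHom.id ℂ) ℂ φ) (fun α => a α •
      SchwartzMap.toTemperedDistributionCLM (Rn n) ℂ volume (hermite α)) s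
    refine this.trans (Finset.sum_congr rfl fun α _ => ?_)
    rw [← toTemperedDistributionCLM_hermite_apply]
    rfl
  simp only [e]

/-- The coefficients of a Hermite expansion are determined by the distribution. -/
lemma IsHermiteExpansion.eq_apply {T : 𝓢'(Rn n, ℂ)} {a : (Fin n → ℕ) → ℂ}
    (h : IsHermiteExpansion T a) (β : Fin n → ℕ) : a β = T (hermite β) := by
  have hβ := isHermiteExpansion_iff.1 h (hermite β)
  have e : (fun α => a α * coeff α (hermite β)) = fun α => if α = β then a β else 0 := by
    funext α
    rw [coeff, integral_hermite_mul_hermite]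
    by_cases hab : α = β
    · simp [hab]
    · simp [hab, Ne.symm hab]
  rw [e] at hβ
  exact (hasSum_ite_eq β _).unique hβ

/-- Expand the test function φ instead of T: its Hermite series converges absolutely in the weight
(1 + ‖x‖)^k, which justifies exchanging the sum with integration against ‖x‖^λ. -/
lemma isHermiteExpansion_of_isGivenBy_norm_cpow [Nontrivial (Rn n)] {lam : ℂ}
    (hlam : -(n : ℝ) < lam.re) {T : 𝓢'(Rn n, ℂ)} (hT : IsGivenBy T fun x => (‖x‖ : ℂ) ^ lam) :
    IsHermiteExpansion T fun α => T (hermite α) := by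
  refine isHermiteExpansion_iff.2 fun φ => ?_
  obtain ⟨k, I, hI, h⟩ := integrable_norm_cpow_mul hlam
  obtain ⟨C, hC, hb⟩ := norm_coeff_mul_hermite_le k φ
  have h' := fun α => h (fun x => coeff α φ * hermite α x) _
    (continuous_const.mul (hermite α).continuous) (hb α)
  have hs := hasSum_integral_of_summable_integral_norm
    (F := fun (α : Fin n → ℕ) (x : Rn n) => (‖x‖ : ℂ) ^ lam * (coeff α φ * hermite α x))
    (fun α => (h' α).1)
    (.of_nonneg_of_le (fun α => integral_nonneg fun x => norm_nonneg _) (fun α => (h' α).2)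
      ((summable_mweight.mul_left C).mul_right I))
  simp only [tsum_mul_left, (hasSum_coeff_mul_hermite φ _).tsum_eq] at hs
  rw [(hT φ).2]
  refine hs.congr_fun ?_
  intro α
  rw [(hT (hermite α)).2, mul_comm, ← integral_const_mul]
  refine integral_congr_ae (.of_forall fun x => ?_)
  ring

/-! ### Reflection symmetry and polar coordinates -/

lemma hermite1D_neg (k : ℕ) (t : ℝ) : hermite1D k (-t) = (-1) ^ k * hermite1D k t := by
  simp only [hermite1D, eval_physHermite_neg, neg_sq]
  ring

lemma integral_norm_cpow_mul_hermite_of_odd (lam : ℂ) {α : Fin n → ℕ} {i : Fin n}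
    (hi : Odd (α i)) : ∫ x : Rn n, (‖x‖ : ℂ) ^ lam * hermite α x = 0 := by
  -- The reflection x_i ↦ -x_i preserves the measure and the norm and changes the sign of h_α, so
  -- the integral equals its own negative.
  set R : Rn n ≃ₗᵢ[ℝ] Rn n := LinearIsometryEquiv.piLpCongrRight 2
    (fun j => if j = i then LinearIsometryEquiv.neg ℝ else LinearIsometryEquiv.refl ℝ ℝ)
  have hR : ∀ (x : Rn n) (j : Fin n), R x j = if j = i then -x j else x j := fun x j => by
    simp only [R, LinearIsometryEquiv.piLpCongrRight_apply]
    split_ifs <;> rfl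
  have hH : ∀ x, hermite α (R x) = -hermite α x := fun x => by
    rw [hermite_apply, hermite_apply, hermiteFn_eq_prod, hermiteFn_eq_prod,
      ← Finset.mul_prod_erase _ _ (Finset.mem_univ i),
      ← Finset.mul_prod_erase _ (fun j => hermite1D (α j) (x j)) (Finset.mem_univ i), hR, if_pos rfl,
      hermite1D_neg, hi.neg_one_pow]
    have : ∏ j ∈ Finset.univ.erase i, hermite1D (α j) (R x j) =
        ∏ j ∈ Finset.univ.erase i, hermite1D (α j) (x j) :=
      Finset.prod_congr rfl fun j hj => by rw [hR, if_neg (Finset.ne_of_mem_erase hj)]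
    rw [this]
    push_cast
    ring
  have h := R.measurePreserving.integral_comp R.toHomeomorph.measurableEmbedding
    (fun x : Rn n => (‖x‖ : ℂ) ^ lam * hermite α x)
  simp only [hH, LinearIsometryEquiv.norm_map, mul_neg, integral_neg] at h
  exact self_eq_neg.1 h.symm

/-- Integration in polar coordinates of a product of a radial and an angular function. -/
lemma integral_eq_sphere_mul_radial [Nontrivial (Rn n)] (F : Rn n → ℂ)
    (f : Metric.sphere (0 : Rn n) 1 → ℂ) (g : ℝ → ℂ)
    (hF : ∀ (ω : Metric.sphere (0 : Rn n) 1) (r : ℝ), 0 < r → F (r • (ω : Rn n)) = f ω * g r) :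
    ∫ x, F x = (∫ ω, f ω ∂(volume : Measure (Rn n)).toSphere) *
      ∫ r in Set.Ioi (0 : ℝ), (r : ℂ) ^ (n - 1) * g r := by
  have hdim : Module.finrank ℝ (Rn n) = n := finrank_euclideanSpace_fin
  calc ∫ x, F x = ∫ x : ({(0)}ᶜ : Set (Rn n)), F x.1 ∂(volume.comap Subtype.val) := by
        rw [integral_subtype_comap (measurableSet_singleton _).compl F, restrict_compl_singleton]
    _ = ∫ p : Metric.sphere (0 : Rn n) 1 × Set.Ioi (0 : ℝ), F (p.2.1 • (p.1 : Rn n))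
          ∂(volume : Measure (Rn n)).toSphere.prod (.volumeIoiPow (n - 1)) := by
      have h := (volume : Measure (Rn n)).measurePreserving_homeomorphUnitSphereProd.integral_comp
        (Homeomorph.measurableEmbedding _)
        (fun p : Metric.sphere (0 : Rn n) 1 × Set.Ioi (0 : ℝ) => F (p.2.1 • (p.1 : Rn n)))
      rw [hdim] at h
      rw [← h]
      refine integral_congr_ae (.of_forall fun x => ?_)
      have hx := congrArg Subtype.val ((homeomorphUnitSphereProd (Rn n)).symm_apply_apply x)
      rw [homeomorphUnitSphereProd_symm_apply_coe] at hx
      simp only [hx]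
    _ = ∫ p : Metric.sphere (0 : Rn n) 1 × Set.Ioi (0 : ℝ), f p.1 * g p.2.1
          ∂(volume : Measure (Rn n)).toSphere.prod (.volumeIoiPow (n - 1)) :=
      integral_congr_ae (.of_forall fun p => hF p.1 p.2.1 p.2.2)
    _ = (∫ ω, f ω ∂(volume : Measure (Rn n)).toSphere) *
          ∫ r : Set.Ioi (0 : ℝ), g r.1 ∂(.volumeIoiPow (n - 1)) :=
      integral_prod_mul f fun r : Set.Ioi (0 : ℝ) => g r.1
    _ = _ := by
      congr 1
      simp only [Measure.volumeIoiPow, ENNReal.ofReal]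
      rw [integral_withDensity_eq_integral_smul,
        integral_subtype_comap measurableSet_Ioi fun a => Real.toNNReal (a ^ (n - 1)) • g a,
        setIntegral_congr_fun measurableSet_Ioi fun x hx => ?_]
      · rw [NNReal.smul_def, Real.coe_toNNReal _ (pow_nonneg hx.out.le _), Complex.real_smul]
        push_cast
        rfl
      · exact (measurable_subtype_coe.pow_const _).real_toNNReal

/-- The substitution t = r² reduces this to the Gamma integral with exponential rate 1/2, whence the
factor 2^(s/2). -/
lemma mellin_gaussian {s : ℂ} (hs : 0 < s.re) :
    ∫ r in Set.Ioi (0 : ℝ), (r : ℂ) ^ (s - 1) * (Real.exp (-(r ^ 2 / 2)) : ℂ) =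
      2 ^ (s / 2) * Complex.Gamma (s / 2) / 2 := by
  have h := mellin_comp_rpow (fun t : ℝ => Complex.exp (-(((1 / 2 : ℝ) : ℂ) * t))) s 2
  have h2 : mellin (fun t : ℝ => Complex.exp (-(((1 / 2 : ℝ) : ℂ) * t))) (s / 2) =
      2 ^ (s / 2) * Complex.Gamma (s / 2) := by
    have := Complex.integral_cpow_mul_exp_neg_mul_Ioi (a := s / 2) (r := 1 / 2)
      (by simpa using hs) (by norm_num)
    simpa [mellin] using this
  have h3 : s / ((2 : ℝ) : ℂ) = s / 2 := by norm_num
  rw [h3, h2] at h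
  have h4 : |(2 : ℝ)|⁻¹ • (2 ^ (s / 2) * Complex.Gamma (s / 2)) =
      2 ^ (s / 2) * Complex.Gamma (s / 2) / 2 := by
    rw [Complex.real_smul]
    push_cast
    simp
    ring
  rw [h4] at h
  rw [← h, mellin]
  refine integral_congr_ae (.of_forall fun r => ?_)
  simp only [smul_eq_mul]
  congr 1
  push_cast
  congr 1
  rw [Real.rpow_ofNat]
  push_cast
  ring

/-- By homogeneity the integrand on the ray rω is ω^δ times a radial function. With r^(n-1) from
polar coordinates, the radial part is the Mellin integral at s = λ + n + |δ|. -/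
lemma integral_norm_cpow_mul_mpow_mul_gaussian [Nontrivial (Rn n)] {lam : ℂ}
    (hlam : -(n : ℝ) < lam.re) (δ : Fin n → ℕ) :
    ∫ x : Rn n, (‖x‖ : ℂ) ^ lam * ((mpow x δ : ℂ) * (Real.exp (-(‖x‖ ^ 2 / 2)) : ℂ)) =
      sphereMoment n (fun _ => 1) δ *
        (2 ^ ((lam + n + mlen δ) / 2) * Complex.Gamma ((lam + n + mlen δ) / 2) / 2) := by
  have hn : 0 < n := by
    have := Module.finrank_pos (R := ℝ) (M := Rn n)
    rwa [finrank_euclideanSpace_fin] at this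
  rw [integral_eq_sphere_mul_radial _ (fun ω => (mpow (ω : Rn n) δ : ℂ) * 1)
    (fun r => (r : ℂ) ^ lam * (r : ℂ) ^ mlen δ * (Real.exp (-(r ^ 2 / 2)) : ℂ)), sphereMoment,
    ← mellin_gaussian]
  · congr 1
    refine setIntegral_congr_fun measurableSet_Ioi fun r hr => ?_
    have hr0 : (r : ℂ) ≠ 0 := by exact_mod_cast (ne_of_gt hr)
    have hc : ((n - 1 : ℕ) : ℂ) = n - 1 := by rw [Nat.cast_sub hn, Nat.cast_one]
    rw [← mul_assoc, show lam + n + mlen δ - 1 = ((n - 1 : ℕ) : ℂ) + (lam + mlen δ) by rw [hc]; ring,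
      Complex.cpow_add _ _ hr0, Complex.cpow_add _ _ hr0, Complex.cpow_natCast, Complex.cpow_natCast]
  · have : (0 : ℝ) ≤ mlen δ := Nat.cast_nonneg _
    simp
    linarith
  · intro ω r hr
    have h1 : ‖r • (ω : Rn n)‖ = r := by
      rw [norm_smul, Real.norm_of_nonneg hr.le, norm_eq_of_mem_sphere, mul_one]
    have h2 : mpow (r • (ω : Rn n)) δ = r ^ mlen δ * mpow (ω : Rn n) δ := by
      simp only [mpow, mlen, PiLp.smul_apply, smul_eq_mul, mul_pow, Finset.prod_mul_distrib,
        Finset.prod_pow_eq_pow_sum]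
    rw [h1, h2]
    push_cast
    ring

/-! ### The coefficients at even multi-indices -/

lemma mlen_two_smul_sub (β γ : Fin n → ℕ) : mlen (2 • β - 2 • γ) = 2 * mlen (β - γ) := by
  simp [mlen, Finset.mul_sum, Nat.mul_sub]

lemma mlen_sub_add {β γ : Fin n → ℕ} (h : γ ≤ β) : mlen (β - γ) + mlen γ = mlen β := by
  rw [mlen, mlen, ← Finset.sum_add_distrib]
  exact Finset.sum_congr rfl fun i _ => Nat.sub_add_cancel (h i)

lemma hermiteFn_two_smul (β : Fin n → ℕ) (x : Rn n) :
    hermiteFn (2 • β) x = (Real.pi ^ ((n : ℝ) / 4) * 2 ^ mlen β * √(mfact (2 • β) : ℝ))⁻¹ *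
      mfact (2 • β) * ∑ γ ∈ Finset.Icc 0 β, (-1) ^ mlen γ * 2 ^ (2 * mlen (β - γ)) /
        (mfact γ * mfact (2 • β - 2 • γ)) *
          (mpow x (2 • β - 2 • γ) * Real.exp (-(‖x‖ ^ 2 / 2))) := by
  have h1 : (2 : ℝ) ^ ((mlen (2 • β) : ℝ) / 2) = 2 ^ mlen β := by
    rw [← Real.rpow_natCast]
    congr 1
    simp [mlen, ← Finset.mul_sum]
  have h2 : Real.exp (-(‖x‖ ^ 2 / 2)) = ∏ j, Real.exp (-(x j ^ 2 / 2)) := by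
    have := exp_neg_mul_norm_sq (1 / 2) x
    simpa [div_eq_inv_mul] using this
  have h3 : ∀ j, hermite1D ((2 • β) j) (x j) = (hermiteNorm ((2 • β) j))⁻¹ *
      (2 * β j).factorial * (∑ g ∈ Finset.Icc 0 (β j), (-1) ^ g * (2 * x j) ^ (2 * β j - 2 * g) /
        (g.factorial * (2 * β j - 2 * g).factorial)) * Real.exp (-(x j ^ 2 / 2)) := fun j => by
    rw [hermite1D, Pi.smul_apply, smul_eq_mul, eval_physHermite_even]
    ring
  rw [← h1, ← prod_hermiteNorm, hermiteFn_eq_prod, Finset.prod_congr rfl fun j _ => h3 j,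
    Finset.prod_mul_distrib, Finset.prod_mul_distrib, Finset.prod_mul_distrib,
    Finset.prod_univ_sum, ← h2, Finset.prod_inv_distrib]
  rw [mul_assoc _ _ (Real.exp _), Finset.sum_mul]
  congr 1
  · simp [mfact]
  -- The box of independent choices of g in each coordinate is `Finset.Icc 0 β` by definition.
  · refine Finset.sum_congr rfl fun γ _ => ?_
    rw [← mul_assoc]
    congr 1
    rw [← mlen_two_smul_sub, Finset.prod_div_distrib, Finset.prod_mul_distrib,
      Finset.prod_mul_distrib, Finset.prod_pow_eq_pow_sum]
    simp only [mul_pow, Finset.prod_mul_distrib, Finset.prod_pow_eq_pow_sum]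
    simp only [mlen, mfact, mpow, Pi.sub_apply, Pi.smul_apply, smul_eq_mul]
    push_cast
    ring

lemma one_add_norm_pow_mul_mpow_mul_gaussian_le (k : ℕ) (δ : Fin n → ℕ) : ∃ B : ℝ, ∀ x : Rn n,
    (1 + ‖x‖) ^ k * ‖mpow x δ * Real.exp (-(‖x‖ ^ 2 / 2))‖ ≤ B := by
  refine ⟨_, fun x => le_trans ?_ (SchwartzMap.one_add_le_sup_seminorm_apply (𝕜 := ℝ)
    (m := (k + mlen δ, 0)) (k := k + mlen δ) (n := 0) le_rfl le_rfl (gaussS n) x)⟩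
  rw [norm_iteratedFDeriv_zero, norm_mul, ← mul_assoc, pow_add]
  have h : ‖mpow x δ‖ ≤ (1 + ‖x‖) ^ mlen δ := by
    rw [mpow, norm_prod, mlen, ← Finset.prod_pow_eq_pow_sum]
    refine Finset.prod_le_prod (fun i _ => norm_nonneg _) fun i _ => ?_
    rw [norm_pow]
    have := PiLp.norm_apply_le x i
    gcongr
    linarith
  change _ ≤ _ * ‖Real.exp (-(‖x‖ ^ 2 / 2))‖
  gcongr

lemma integral_norm_cpow_mul_hermite_two_smul [Nontrivial (Rn n)] {lam : ℂ}
    (hlam : -(n : ℝ) < lam.re) (β : Fin n → ℕ) :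
    ∫ x : Rn n, (‖x‖ : ℂ) ^ lam * hermite (2 • β) x =
      (Real.pi : ℂ) ^ (-(n : ℂ) / 4) * (2 : ℂ) ^ (2 * (mlen β : ℂ) + (lam + n) / 2 - 1)
        * (√(mfact (2 • β) : ℝ) : ℂ)
        * ∑ γ ∈ Finset.Icc 0 β, Complex.Gamma ((mlen (β - γ) : ℂ) + (lam + n) / 2)
            / ((mfact γ : ℂ) * (mfact (2 • β - 2 • γ) : ℂ))
            * ((-1) ^ mlen γ / 2 ^ (3 * mlen γ))
            * sphereMoment n (fun _ => 1) (2 • β - 2 • γ) := by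
  obtain ⟨k, I, -, hint⟩ := integrable_norm_cpow_mul hlam
  have hi : ∀ δ : Fin n → ℕ, Integrable fun x : Rn n =>
      (‖x‖ : ℂ) ^ lam * ((mpow x δ : ℂ) * (Real.exp (-(‖x‖ ^ 2 / 2)) : ℂ)) := fun δ => by
    obtain ⟨B, hB⟩ := one_add_norm_pow_mul_mpow_mul_gaussian_le k δ
    refine (hint _ B ?_ fun x => ?_).1
    · unfold mpow
      fun_prop
    · rw [← Complex.ofReal_mul, Complex.norm_real]
      exact hB x
  set c : ℂ := (((Real.pi ^ ((n : ℝ) / 4) * 2 ^ mlen β * √(mfact (2 • β) : ℝ))⁻¹ *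
      mfact (2 • β) : ℝ) : ℂ)
  have e : ∀ x : Rn n, (‖x‖ : ℂ) ^ lam * hermite (2 • β) x = c * ∑ γ ∈ Finset.Icc 0 β,
      ((-1) ^ mlen γ * 2 ^ (2 * mlen (β - γ)) / (mfact γ * mfact (2 • β - 2 • γ)) : ℂ) *
        ((‖x‖ : ℂ) ^ lam * ((mpow x (2 • β - 2 • γ) : ℂ) *
          (Real.exp (-(‖x‖ ^ 2 / 2)) : ℂ))) := fun x => by
    rw [hermite_apply, hermiteFn_two_smul, Complex.ofReal_mul, mul_left_comm, Complex.ofReal_sum,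
      Finset.mul_sum]
    congr 1
    refine Finset.sum_congr rfl fun γ _ => ?_
    push_cast
    ring
  simp_rw [e]
  rw [integral_const_mul, integral_finsetSum _ fun γ _ => (hi _).const_mul _, Finset.mul_sum,
    Finset.mul_sum]
  refine Finset.sum_congr rfl fun γ hγ => ?_
  have hl := mlen_sub_add (Finset.mem_Icc.1 hγ).2
  rw [integral_const_mul, integral_norm_cpow_mul_mpow_mul_gaussian hlam, mlen_two_smul_sub]
  have e1 : (lam + n + ((2 * mlen (β - γ) : ℕ) : ℂ)) / 2 =
      (mlen (β - γ) : ℂ) + (lam + n) / 2 := by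
    push_cast
    ring
  -- Powers of 2: the normalisation gives -|β|, the monomial 2|β-γ|, the Mellin integral |β-γ| +
  -- (λ+n)/2 - 1. The total is 2|β| + (λ+n)/2 - 1 - 3|γ|, which explains the factor 2^(-3|γ|).
  rw [e1, Complex.cpow_add _ _ two_ne_zero, Complex.cpow_natCast,
    Complex.cpow_sub _ _ two_ne_zero, Complex.cpow_add _ _ two_ne_zero, Complex.cpow_one,
    show 2 * (mlen β : ℂ) = ((2 * mlen β : ℕ) : ℂ) by push_cast; rfl, Complex.cpow_natCast, ← hl]
  have hF : (0 : ℝ) < mfact (2 • β) := by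
    simp only [mfact]
    exact_mod_cast Finset.prod_pos fun i _ => Nat.factorial_pos _
  have hFF : (√(mfact (2 • β) : ℝ) : ℂ) ^ 2 = mfact (2 • β) := by
    exact_mod_cast Real.sq_sqrt hF.le
  have hF0 : (√(mfact (2 • β) : ℝ) : ℂ) ≠ 0 := by
    exact_mod_cast (Real.sqrt_pos.2 hF).ne'
  -- The factor (2β)! from the Hermite polynomials, divided by its square root from the
  -- normalisation, leaves the square root.
  have hc : c = (Real.pi : ℂ) ^ (-(n : ℂ) / 4) * (2 ^ (mlen (β - γ) + mlen γ))⁻¹ *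
      (√(mfact (2 • β) : ℝ) : ℂ) := by
    have hp : (Real.pi : ℂ) ^ (-(n : ℂ) / 4) = ((Real.pi ^ ((n : ℝ) / 4) : ℝ) : ℂ)⁻¹ := by
      rw [Complex.ofReal_cpow Real.pi_pos.le, ← Complex.cpow_neg]
      push_cast
      ring_nf
    rw [hp, hl]
    simp only [c]
    push_cast
    rw [← hFF]
    field_simp
  rw [hc]
  have h2 : (2 : ℂ) ≠ 0 := two_ne_zero
  generalize Complex.Gamma _ = G
  generalize (2 : ℂ) ^ ((lam + n) / 2) = W
  generalize sphereMoment n (fun _ => 1) (2 • β - 2 • γ) = M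
  generalize mlen (β - γ) = p
  generalize mlen γ = q
  simp only [pow_add, pow_mul', mul_add]
  field_simp

end HermiteExp

end

/-! ### The main theorem -/

theorem theorem4p2 (n : ℕ) (hn : 2 ≤ n) (lam : ℂ) (hlam : -(n : ℝ) < lam.re) :
    ∃ T : 𝓢'(HermiteExp.Rn n, ℂ),
      HermiteExp.IsGivenBy T (fun x => (‖x‖ : ℂ) ^ lam) ∧
      ∃ a : (Fin n → ℕ) → ℂ,
        HermiteExp.IsHermiteExpansion T a ∧
        (∀ b : (Fin n → ℕ) → ℂ, HermiteExp.IsHermiteExpansion T b → b = a) ∧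
        (∀ α : Fin n → ℕ, a α = T (HermiteExp.hermite α)) ∧
        (∀ β : Fin n → ℕ,
          a (2 • β) =
            (Real.pi : ℂ) ^ (-(n : ℂ) / 4)
              * (2 : ℂ) ^ (2 * (HermiteExp.mlen β : ℂ) + (lam + n) / 2 - 1)
              * (√(HermiteExp.mfact (2 • β) : ℝ) : ℂ)
              * ∑ γ ∈ Finset.Icc 0 β,
                  Complex.Gamma ((HermiteExp.mlen (β - γ) : ℂ) + (lam + n) / 2)
                      / ((HermiteExp.mfact γ : ℂ)
                        * (HermiteExp.mfact (2 • β - 2 • γ) : ℂ))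
                    * ((-1) ^ HermiteExp.mlen γ / 2 ^ (3 * HermiteExp.mlen γ))
                    * HermiteExp.sphereMoment n (fun _ => 1) (2 • β - 2 • γ)) ∧
        (∀ α : Fin n → ℕ, (¬ ∃ β : Fin n → ℕ, α = 2 • β) → a α = 0) := by
  have : Nontrivial (HermiteExp.Rn n) := by
    have : Nonempty (Fin n) := ⟨⟨0, by omega⟩⟩
    infer_instance
  obtain ⟨T, hT⟩ := HermiteExp.exists_isGivenBy_norm_cpow hlam
  refine ⟨T, hT, fun α => T (HermiteExp.hermite α),
    HermiteExp.isHermiteExpansion_of_isGivenBy_norm_cpow hlam hT,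
    fun b hb => funext hb.eq_apply, fun _ => rfl, fun β => ?_, fun α hα => ?_⟩
  · exact (hT _).2.trans (HermiteExp.integral_norm_cpow_mul_hermite_two_smul hlam β)
  · obtain ⟨i, hi⟩ : ∃ i, Odd (α i) := by
      by_contra! h
      refine hα ⟨fun i => α i / 2, funext fun i => ?_⟩
      have := Nat.not_odd_iff_even.1 (h i)
      simp only [Pi.smul_apply, smul_eq_mul]
      exact (Nat.two_mul_div_two_of_even this).symm
    exact (hT _).2.trans (HermiteExp.integral_norm_cpow_mul_hermite_of_odd lam hi)
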